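/- Let $B=\{x\in\mathbb R^2:|x|<1\}$ be the open unit disc and let $\Gamma=\{(x_1,0):x_1\ge 0\}\cup\{(0,x_2):x_2\ge 0\}$. Let $q_1,q_2\in\mathbb C$ be two distinct nonzero constants, and let $u=(u_1,u_2)$ and $v=(v_1,v_2)$ be $\mathbb C^2$-valued functions of class $C^2$ on $B$ such that $$ \begin{cases} \Delta u+q_1u=0 & \text{in } B,\\ \Delta v+q_2v=0 & \text{in } B,\\ \operatorname{div}u=\operatorname{div}v=0 & \text{in } B,\\ \tau\cdot u=\tau\cdot v & \text{on } (B\cap\Gamma)\setminus\{0\},\\ \nabla\times u=\nabla\times v & \text{on } B\cap\Gamma, \end{cases} $$ where $\Delta$ acts componentwise, $\operatorname{div}u=\partial_1u_1+\partial_2u_2$, $\nabla\times u=\partial_1u_2-\partial_2u_1$, $\tau=(1,0)$ at the points $(x_1,0)$ with $x_1>0$, and $\tau=(0,1)$ at the points $(0,x_2)$ with $x_2>0$. Then $u=0$ and $v=0$ identically in $B$. -/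

import Mathlib

namespace CornerMaxwell

/-- The plane `ℝ²`; the coordinates `x₁, x₂` are `x 0, x 1`. -/
abbrev Plane : Type := EuclideanSpace ℝ (Fin 2)

/-- The space `ℂ²` of values of the fields. -/
abbrev CVec : Type := EuclideanSpace ℂ (Fin 2)

/-- The open unit disc `B = {x : |x| < 1}`. -/
def unitDisc : Set Plane := {x | ‖x‖ < 1}

/-- The right corner: the union of the two closed positive half-axes. -/
def corner : Set Plane :=
  {x | 0 ≤ x 0 ∧ x 1 = 0} ∪ {x | x 0 = 0 ∧ 0 ≤ x 1}

/-- The partial derivative `∂ⱼ uᵢ` at `x`. -/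
noncomputable def partialDeriv (j i : Fin 2) (u : Plane → CVec) (x : Plane) : ℂ :=
  fderiv ℝ (fun y : Plane => u y i) x (EuclideanSpace.single j 1)

/-- The divergence `∂₁ u₁ + ∂₂ u₂`. -/
noncomputable def divergence (u : Plane → CVec) (x : Plane) : ℂ :=
  partialDeriv 0 0 u x + partialDeriv 1 1 u x

/-- The scalar curl `∇ × u = ∂₁ u₂ - ∂₂ u₁`. -/
noncomputable def curl (u : Plane → CVec) (x : Plane) : ℂ :=
  partialDeriv 0 1 u x - partialDeriv 1 0 u x

open Classical in
/-- A unit tangent `τ` to the corner, defined away from the vertex: the first standard basis vector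
on the horizontal side, the second one on the vertical side. (The value off the corner and at its
vertex is irrelevant.) -/
noncomputable def tangent (x : Plane) : Plane :=
  if x 1 = 0 then EuclideanSpace.single 0 1 else EuclideanSpace.single 1 1

/-- The bilinear product `t · z = t₁ z₁ + t₂ z₂` of a real vector and a complex vector. -/
noncomputable def dot (t : Plane) (z : CVec) : ℂ :=
  (t 0 : ℂ) * z 0 + (t 1 : ℂ) * z 1

/-- `u` is a (classical, twice continuously differentiable) solution in the unit disc of the vector
Helmholtz equation `Δu + q u = 0`; the vector Laplacian acts componentwise. -/
def IsHelmholtzSolution (q : ℂ) (u : Plane → CVec) : Prop :=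
  ContDiffOn ℝ 2 u unitDisc ∧
    ∀ x ∈ unitDisc, Laplacian.laplacian u x + q • u x = 0

end CornerMaxwell

open MeasureTheory Set Filter Topology
open scoped ContDiff Convolution

namespace CornerMaxwell

/-! ### The recurrence for the Taylor coefficients -/

/-! The problem reduces to two scalar functions, the curls F of u and G of v. Since the fields are
divergence free, ∂₂F = q₁u₁ and ∂₁F = -q₁u₂ (`exists_curl_potential`), so F solves ΔF + q₁F = 0;
likewise G with q₂. On each side of the corner F = G, and the tangential condition says that the
normal derivatives are in the ratio q₁/q₂.

Let a and b be the arrays of derivatives ∂₁ʲ∂₂ᵏ of F and G at the vertex. The equations give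
a(j+2,k) + a(j,k+2) = -q₁a(j,k), and the same for b with q₂; the corner data relate the rows k = 0,
1 and the columns j = 0, 1 of a to those of b. Splitting by parity leaves arrays with a one-step
recurrence, whose first rows are in a ratio μ and first columns in a ratio ν. If m is the first
place where a row entry could be nonzero, the recurrence carries row entries to column entries along
antidiagonals. For μ ≠ ν the antidiagonal m forces the entry to vanish; for μ = ν this is vacuous,
and the next one forces it because q₁ ≠ q₂. So F and G are flat at the vertex
(`taylorCoeff_eq_zero`), hence so are u and v.

Two analytic facts complete this. Solutions are smooth near 0 (`exists_contDiff_eventuallyEq`, from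
a mean value property), so all derivatives exist; and a solution flat at 0 vanishes on the disc
(`eq_zero_of_flat`, through Bessel's equation for the angular Fourier modes). -/

theorem antidiagonal_of_recurrence {q : ℂ} {α : ℕ → ℕ → ℂ}
    (h : ∀ j k, α (j + 1) k + α j (k + 1) = -q * α j k) {m : ℕ} (h0 : ∀ i < m, α i 0 = 0) (k : ℕ) :
    (∀ j, j + k < m → α j k = 0) ∧ (∀ j, j + k = m → α j k = (-1) ^ k * α m 0) ∧
      (∀ j, j + k = m + 1 → α j k = (-1) ^ k * (α (m + 1) 0 + k * q * α m 0)) := by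
  induction k with
  | zero =>
    refine ⟨fun j hj => h0 j hj, fun j hj => ?_, fun j hj => ?_⟩
    · obtain rfl : j = m := by omega
      simp
    · obtain rfl : j = m + 1 := by omega
      simp
  | succ k ih =>
    obtain ⟨h1, h2, h3⟩ := ih
    have hs : ∀ j, α j (k + 1) = -q * α j k - α (j + 1) k := fun j => by
      rw [← h j k]; ring
    refine ⟨fun j hj => ?_, fun j hj => ?_, fun j hj => ?_⟩
    · rw [hs, h1 j (by omega), h1 (j + 1) (by omega)]; simp
    · rw [hs, h1 j (by omega), h2 (j + 1) (by omega)]; ring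
    · rw [hs, h2 j (by omega), h3 (j + 1) (by omega)]; push_cast; ring

theorem eq_zero_of_recurrence_of_row {q : ℂ} {α : ℕ → ℕ → ℂ}
    (h : ∀ j k, α (j + 1) k + α j (k + 1) = -q * α j k) (h0 : ∀ i, α i 0 = 0) (j k : ℕ) :
    α j k = 0 :=
  (antidiagonal_of_recurrence h (m := j + k + 1) (fun i _ => h0 i) k).1 j (by omega)

/-- Two solutions of the recurrences with different parameters whose boundary values are
proportional on each of the two sides of the quadrant vanish. -/
theorem eq_zero_of_recurrence_of_proportional {q₁ q₂ μ ν : ℂ} (hq : q₁ ≠ q₂) (hμ : μ ≠ 0)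
    {α β : ℕ → ℕ → ℂ}
    (hα : ∀ j k, α (j + 1) k + α j (k + 1) = -q₁ * α j k)
    (hβ : ∀ j k, β (j + 1) k + β j (k + 1) = -q₂ * β j k)
    (hrow : ∀ j, α j 0 = μ * β j 0) (hcol : ∀ k, α 0 k = ν * β 0 k) :
    (∀ j k, α j k = 0) ∧ ∀ j k, β j k = 0 := by
  have key : ∀ m, β m 0 = 0 := by
    intro m
    induction m using Nat.strong_induction_on with
    | _ m ih =>
      have hβ0 : ∀ i < m, β i 0 = 0 := ih
      have hα0 : ∀ i < m, α i 0 = 0 := fun i hi => by rw [hrow, ih i hi, mul_zero]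
      have hs : ∀ k : ℕ, ((-1 : ℂ)) ^ k ≠ 0 := fun k => pow_ne_zero _ (by norm_num)
      -- When μ = ν the leading antidiagonal gives no information. On the next one the unknown entry
      -- at m + 1 cancels, leaving (m+1)(q₁ - q₂) times the entry at m.
      by_cases hμν : μ = ν
      · have h1 := (antidiagonal_of_recurrence hα hα0 (m + 1)).2.2 0 (by omega)
        have h2 := (antidiagonal_of_recurrence hβ hβ0 (m + 1)).2.2 0 (by omega)
        rw [hcol, h2, hrow, hrow, ← hμν] at h1
        have h3 : (-1 : ℂ) ^ (m + 1) * (μ * (((m + 1 : ℕ) : ℂ) * ((q₁ - q₂) * β m 0))) = 0 := by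
          linear_combination -h1
        have h4 : ((m + 1 : ℕ) : ℂ) ≠ 0 := by exact_mod_cast Nat.succ_ne_zero m
        simpa [hs, hμ, h4, sub_eq_zero, hq, Nat.cast_add_one_ne_zero] using h3
      · have h1 := (antidiagonal_of_recurrence hα hα0 m).2.1 0 (by omega)
        have h2 := (antidiagonal_of_recurrence hβ hβ0 m).2.1 0 (by omega)
        rw [hcol, h2, hrow] at h1
        have h3 : (-1 : ℂ) ^ m * ((μ - ν) * β m 0) = 0 := by linear_combination -h1
        simpa [hs, sub_eq_zero, hμν] using h3
  exact ⟨eq_zero_of_recurrence_of_row hα fun i => by rw [hrow, key, mul_zero],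
    eq_zero_of_recurrence_of_row hβ key⟩

/-- Steps of size two preserve the parities s of j and t of k, so four independent arrays arise. An
even parity sees the values on a side (ratio 1), an odd one the normal derivatives (ratio q₁/q₂). -/
theorem taylorCoeff_eq_zero {q₁ q₂ : ℂ} (hq₁ : q₁ ≠ 0) (hq₂ : q₂ ≠ 0) (hq : q₁ ≠ q₂)
    {a b : ℕ → ℕ → ℂ}
    (ha : ∀ j k, a (j + 2) k + a j (k + 2) = -q₁ * a j k)
    (hb : ∀ j k, b (j + 2) k + b j (k + 2) = -q₂ * b j k)
    (hrow : ∀ j, a j 0 = b j 0) (hcol : ∀ k, a 0 k = b 0 k)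
    (hrow' : ∀ j, a j 1 = q₁ / q₂ * b j 1) (hcol' : ∀ k, a 1 k = q₁ / q₂ * b 1 k) (j k : ℕ) :
    a j k = 0 ∧ b j k = 0 := by
  have main : ∀ s t : ℕ, s < 2 → t < 2 → ∀ j k,
      a (2 * j + s) (2 * k + t) = 0 ∧ b (2 * j + s) (2 * k + t) = 0 := by
    intro s t hs ht j k
    have hqq : q₁ / q₂ ≠ 0 := div_ne_zero hq₁ hq₂
    have h := eq_zero_of_recurrence_of_proportional (μ := if t = 0 then 1 else q₁ / q₂)
      (ν := if s = 0 then 1 else q₁ / q₂) hq (by split_ifs <;> simp_all)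
      (α := fun j k => a (2 * j + s) (2 * k + t)) (β := fun j k => b (2 * j + s) (2 * k + t))
      (fun j k => by
        have := ha (2 * j + s) (2 * k + t)
        rwa [show 2 * j + s + 2 = 2 * (j + 1) + s by ring,
          show 2 * k + t + 2 = 2 * (k + 1) + t by ring] at this)
      (fun j k => by
        have := hb (2 * j + s) (2 * k + t)
        rwa [show 2 * j + s + 2 = 2 * (j + 1) + s by ring,
          show 2 * k + t + 2 = 2 * (k + 1) + t by ring] at this)
      (fun j => by interval_cases t <;> simp [hrow, hrow'])
      (fun k => by interval_cases s <;> simp [hcol, hcol'])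
    exact ⟨h.1 j k, h.2 j k⟩
  have := main (j % 2) (k % 2) (Nat.mod_lt _ two_pos) (Nat.mod_lt _ two_pos) (j / 2) (k / 2)
  rwa [Nat.div_add_mod, Nat.div_add_mod] at this

/-! ### Partial derivatives of scalar functions on the plane -/

/-- The partial derivative `∂ⱼ f`. -/
noncomputable def pderiv (j : Fin 2) (f : Plane → ℂ) (x : Plane) : ℂ :=
  fderiv ℝ f x (EuclideanSpace.single j 1)

/-- `f` solves the scalar Helmholtz equation at `x`. -/
def HelmholtzAt (q : ℂ) (f : Plane → ℂ) (x : Plane) : Prop :=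
  pderiv 0 (pderiv 0 f) x + pderiv 1 (pderiv 1 f) x + q * f x = 0

theorem fderiv_apply_eq_pderiv (f : Plane → ℂ) (x v : Plane) :
    fderiv ℝ f x v = v 0 * pderiv 0 f x + v 1 * pderiv 1 f x := by
  have hv : v = v 0 • EuclideanSpace.single 0 (1 : ℝ) + v 1 • EuclideanSpace.single 1 (1 : ℝ) := by
    ext i; fin_cases i <;> simp
  conv_lhs => rw [hv]
  rw [map_add, map_smul, map_smul]
  simp [pderiv]

theorem contDiff_pderiv {m n : WithTop ℕ∞} {f : Plane → ℂ} (hf : ContDiff ℝ n f) (h : m + 1 ≤ n)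
    (j : Fin 2) : ContDiff ℝ m (pderiv j f) :=
  (hf.fderiv_right h).clm_apply contDiff_const

theorem pderiv_pderiv_eq {f : Plane → ℂ} {x : Plane} (hf : ContDiffAt ℝ 2 f x) (i j : Fin 2) :
    pderiv i (pderiv j f) x =
      fderiv ℝ (fderiv ℝ f) x (EuclideanSpace.single i 1) (EuclideanSpace.single j 1) := by
  have hd : DifferentiableAt ℝ (fderiv ℝ f) x :=
    (hf.fderiv_right (m := 1) (by norm_num)).differentiableAt (by norm_num)
  change fderiv ℝ (fun y => fderiv ℝ f y (EuclideanSpace.single j 1)) x _ = _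
  rw [fderiv_clm_apply hd (differentiableAt_const _)]
  simp

theorem pderiv_comm {f : Plane → ℂ} (hf : ContDiff ℝ 2 f) (i j : Fin 2) :
    pderiv i (pderiv j f) = pderiv j (pderiv i f) := by
  funext x
  rw [pderiv_pderiv_eq hf.contDiffAt, pderiv_pderiv_eq hf.contDiffAt]
  exact hf.contDiffAt.isSymmSndFDerivAt (by simp) _ _

theorem pderiv_congr {f g : Plane → ℂ} {x : Plane} (h : f =ᶠ[𝓝 x] g) (j : Fin 2) :
    pderiv j f =ᶠ[𝓝 x] pderiv j g := by
  filter_upwards [h.fderiv (𝕜 := ℝ)] with y hy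
  simp [pderiv, hy]

theorem HelmholtzAt.congr {q : ℂ} {f g : Plane → ℂ} {x : Plane} (h : f =ᶠ[𝓝 x] g)
    (hf : HelmholtzAt q f x) : HelmholtzAt q g x := by
  unfold HelmholtzAt at *
  rw [← (pderiv_congr (pderiv_congr h 0) 0).eq_of_nhds,
    ← (pderiv_congr (pderiv_congr h 1) 1).eq_of_nhds, ← h.eq_of_nhds, hf]

theorem hasDerivAt_comp_curve {f : Plane → ℂ} {γ : ℝ → Plane} {v : Plane} {t : ℝ}
    (hf : DifferentiableAt ℝ f (γ t)) (hγ : HasDerivAt γ v t) :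
    HasDerivAt (fun s => f (γ s)) (v 0 * pderiv 0 f (γ t) + v 1 * pderiv 1 f (γ t)) t := by
  rw [← fderiv_apply_eq_pderiv]
  exact hf.hasFDerivAt.comp_hasDerivAt t hγ

/-! ### Angular Fourier modes -/

/-- Polar coordinates. -/
noncomputable def polarPoint (r θ : ℝ) : Plane := !₂[r * Real.cos θ, r * Real.sin θ]

@[simp] theorem polarPoint_zero_apply (r θ : ℝ) : polarPoint r θ 0 = r * Real.cos θ := rfl
@[simp] theorem polarPoint_one_apply (r θ : ℝ) : polarPoint r θ 1 = r * Real.sin θ := rfl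

theorem norm_polarPoint (r θ : ℝ) : ‖polarPoint r θ‖ = |r| := by
  rw [EuclideanSpace.norm_eq, Fin.sum_univ_two]
  simp only [polarPoint_zero_apply, polarPoint_one_apply, Real.norm_eq_abs, sq_abs]
  rw [← Real.sqrt_sq_eq_abs]
  congr 1
  linear_combination r ^ 2 * Real.cos_sq_add_sin_sq θ

theorem continuous_polarPoint : Continuous fun p : ℝ × ℝ => polarPoint p.1 p.2 := by
  unfold polarPoint
  refine (PiLp.continuous_toLp 2 _).comp (continuous_pi fun i => ?_)
  fin_cases i <;> simp <;> fun_prop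

theorem hasDerivAt_plane {a b : ℝ → ℝ} {a' b' t : ℝ} (ha : HasDerivAt a a' t)
    (hb : HasDerivAt b b' t) : HasDerivAt (fun s => (!₂[a s, b s] : Plane)) !₂[a', b'] t := by
  have h : HasDerivAt (fun s => ![a s, b s]) ![a', b'] t := by
    rw [hasDerivAt_pi]
    intro i
    fin_cases i
    · exact ha
    · exact hb
  exact (PiLp.hasFDerivAt_toLp (𝕜 := ℝ) 2 _).comp_hasDerivAt t h

theorem hasDerivAt_polarPoint_radius (r θ : ℝ) :
    HasDerivAt (fun s => polarPoint s θ) !₂[Real.cos θ, Real.sin θ] r := by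
  have h := hasDerivAt_plane ((hasDerivAt_id r).mul_const (Real.cos θ))
    ((hasDerivAt_id r).mul_const (Real.sin θ))
  simp only [one_mul] at h
  exact h

theorem hasDerivAt_polarPoint_angle (r θ : ℝ) :
    HasDerivAt (fun s => polarPoint r s) !₂[r * -Real.sin θ, r * Real.cos θ] θ :=
  hasDerivAt_plane ((Real.hasDerivAt_cos θ).const_mul r) ((Real.hasDerivAt_sin θ).const_mul r)

/-- The radial derivative in polar coordinates. -/
noncomputable def radialDeriv (g : Plane → ℂ) (r θ : ℝ) : ℂ :=
  (Real.cos θ : ℂ) * pderiv 0 g (polarPoint r θ) + (Real.sin θ : ℂ) * pderiv 1 g (polarPoint r θ)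

/-- The second radial derivative in polar coordinates. -/
noncomputable def radialDerivTwo (g : Plane → ℂ) (r θ : ℝ) : ℂ :=
  (Real.cos θ : ℂ) * radialDeriv (pderiv 0 g) r θ + (Real.sin θ : ℂ) * radialDeriv (pderiv 1 g) r θ

/-- The character `e^{-inθ}`. -/
noncomputable def angularChar (n : ℤ) (θ : ℝ) : ℂ := Complex.exp (-(n * θ * Complex.I))

/-- The `n`-th Fourier coefficient (up to normalization) of a function of the angle. -/
noncomputable def angularMode (n : ℤ) (P : ℝ → ℝ → ℂ) (r : ℝ) : ℂ :=
  ∫ θ in (-Real.pi)..Real.pi, P r θ * angularChar n θ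

theorem continuous_angularChar (n : ℤ) : Continuous (angularChar n) := by
  unfold angularChar; fun_prop

theorem hasDerivAt_angularChar (n : ℤ) (θ : ℝ) :
    HasDerivAt (angularChar n) (-(n * Complex.I) * angularChar n θ) θ := by
  have h : HasDerivAt (fun t : ℝ => -((n : ℂ) * t * Complex.I)) (-(n * Complex.I)) θ := by
    have := (((hasDerivAt_id θ).ofReal_comp.const_mul (n : ℂ)).mul_const Complex.I).neg
    simp only [Complex.ofReal_one, mul_one] at this
    exact this
  have := h.cexp
  rw [mul_comm]; exact this

theorem norm_angularChar (n : ℤ) (θ : ℝ) : ‖angularChar n θ‖ = 1 := by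
  have : angularChar n θ = Complex.exp (((-(n * θ) : ℝ) : ℂ) * Complex.I) := by
    unfold angularChar; congr 1; push_cast; ring
  rw [this, Complex.norm_exp_ofReal_mul_I]

theorem angularChar_pi (n : ℤ) : angularChar n Real.pi = angularChar n (-Real.pi) := by
  unfold angularChar
  rw [Complex.exp_eq_exp_iff_exists_int]
  exact ⟨-n, by push_cast; ring⟩

theorem polarPoint_pi (r : ℝ) : polarPoint r Real.pi = polarPoint r (-Real.pi) := by
  simp [polarPoint]

theorem hasDerivAt_intervalIntegral_of_continuous {F F' : ℝ → ℝ → ℂ} {a b : ℝ}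
    (hF : Continuous fun p : ℝ × ℝ => F p.1 p.2) (hF' : Continuous fun p : ℝ × ℝ => F' p.1 p.2)
    (h : ∀ r θ, HasDerivAt (fun s => F s θ) (F' r θ) r) (r : ℝ) :
    HasDerivAt (fun s => ∫ θ in a..b, F s θ) (∫ θ in a..b, F' r θ) r := by
  obtain ⟨C, hC⟩ := ((isCompact_closedBall r 1).prod (isCompact_uIcc (a := a) (b := b))).bddAbove_image
    (f := fun p : ℝ × ℝ => ‖F' p.1 p.2‖) hF'.norm.continuousOn
  have hc : ∀ s, Continuous (F s) := fun s => hF.comp (by fun_prop : Continuous fun θ => (s, θ))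
  have hc' : ∀ s, Continuous (F' s) := fun s => hF'.comp (by fun_prop : Continuous fun θ => (s, θ))
  refine (intervalIntegral.hasDerivAt_integral_of_dominated_loc_of_deriv_le
    (bound := fun _ => C) (Metric.closedBall_mem_nhds r one_pos)
    (Eventually.of_forall fun s => (hc s).aestronglyMeasurable) ((hc r).intervalIntegrable _ _)
    (hc' r).aestronglyMeasurable (Eventually.of_forall fun θ hθ s hs => ?_)
    intervalIntegrable_const (Eventually.of_forall fun θ _ s _ => h s θ)).2
  exact hC ⟨(s, θ), ⟨hs, uIoc_subset_uIcc hθ⟩, rfl⟩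

theorem continuous_radialDeriv {g : Plane → ℂ} (hg : ContDiff ℝ 1 g) :
    Continuous fun p : ℝ × ℝ => radialDeriv g p.1 p.2 := by
  have h := fun j => ((contDiff_pderiv (m := 0) hg (by norm_num) j).continuous.comp
    continuous_polarPoint)
  have h0 := h 0
  have h1 := h 1
  simp only [Function.comp_def] at h0 h1
  unfold radialDeriv
  fun_prop

theorem hasDerivAt_radius {g : Plane → ℂ} (hg : ContDiff ℝ 1 g) (r θ : ℝ) :
    HasDerivAt (fun s => g (polarPoint s θ)) (radialDeriv g r θ) r := by
  have := hasDerivAt_comp_curve (hg.differentiable one_ne_zero _) (hasDerivAt_polarPoint_radius r θ)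
  simpa [radialDeriv] using this

theorem hasDerivAt_radialDeriv {g : Plane → ℂ} (hg : ContDiff ℝ 2 g) (r θ : ℝ) :
    HasDerivAt (fun s => radialDeriv g s θ) (radialDerivTwo g r θ) r :=
  ((hasDerivAt_radius (contDiff_pderiv hg (by norm_num) 0) r θ).const_mul _).add
    ((hasDerivAt_radius (contDiff_pderiv hg (by norm_num) 1) r θ).const_mul _)

theorem continuous_radialDerivTwo {g : Plane → ℂ} (hg : ContDiff ℝ 2 g) :
    Continuous fun p : ℝ × ℝ => radialDerivTwo g p.1 p.2 := by
  have h0 := continuous_radialDeriv (contDiff_pderiv (m := 1) hg (by norm_num) 0)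
  have h1 := continuous_radialDeriv (contDiff_pderiv (m := 1) hg (by norm_num) 1)
  unfold radialDerivTwo
  fun_prop

theorem hasDerivAt_angularMode (n : ℤ) {P P' : ℝ → ℝ → ℂ}
    (hP : Continuous fun p : ℝ × ℝ => P p.1 p.2) (hP' : Continuous fun p : ℝ × ℝ => P' p.1 p.2)
    (h : ∀ r θ, HasDerivAt (fun s => P s θ) (P' r θ) r) (r : ℝ) :
    HasDerivAt (angularMode n P) (angularMode n P' r) r := by
  have hc := continuous_angularChar n
  exact hasDerivAt_intervalIntegral_of_continuous (F := fun r θ => P r θ * angularChar n θ)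
    (F' := fun r θ => P' r θ * angularChar n θ) (by fun_prop) (by fun_prop)
    (fun r θ => (h r θ).mul_const _) r

/-- The angular derivative in polar coordinates. -/
noncomputable def angularDeriv (g : Plane → ℂ) (r θ : ℝ) : ℂ :=
  ((r * -Real.sin θ : ℝ) : ℂ) * pderiv 0 g (polarPoint r θ) +
    ((r * Real.cos θ : ℝ) : ℂ) * pderiv 1 g (polarPoint r θ)

theorem hasDerivAt_angle {g : Plane → ℂ} (hg : ContDiff ℝ 1 g) (r θ : ℝ) :
    HasDerivAt (fun s => g (polarPoint r s)) (angularDeriv g r θ) θ :=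
  hasDerivAt_comp_curve (hg.differentiable one_ne_zero _) (hasDerivAt_polarPoint_angle r θ)

/-- This is r²Δ = r²∂ᵣ² + r∂ᵣ + ∂_θ², solved for the second angular derivative. -/
theorem hasDerivAt_angularDeriv {q : ℂ} {g : Plane → ℂ} (hg : ContDiff ℝ 2 g) {r θ : ℝ}
    (hH : HelmholtzAt q g (polarPoint r θ)) :
    HasDerivAt (angularDeriv g r) (-((r : ℂ) ^ 2 * radialDerivTwo g r θ + r * radialDeriv g r θ +
      q * r ^ 2 * g (polarPoint r θ))) θ := by
  have hD := fun j => hasDerivAt_angle (contDiff_pderiv (m := 1) hg (by norm_num) j) r θ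
  have hcos : HasDerivAt (fun s => ((r * Real.cos s : ℝ) : ℂ)) ((r * -Real.sin θ : ℝ) : ℂ) θ :=
    ((Real.hasDerivAt_cos θ).const_mul r).ofReal_comp
  have hsin : HasDerivAt (fun s => ((r * -Real.sin s : ℝ) : ℂ)) ((r * -Real.cos θ : ℝ) : ℂ) θ :=
    ((Real.hasDerivAt_sin θ).neg.const_mul r).ofReal_comp
  refine ((hsin.mul (hD 0)).add (hcos.mul (hD 1))).congr_deriv ?_
  unfold HelmholtzAt at hH
  unfold radialDerivTwo radialDeriv angularDeriv
  rw [pderiv_comm hg 1 0]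
  have hcs : (Real.cos θ : ℂ) ^ 2 + (Real.sin θ : ℂ) ^ 2 = 1 := by
    exact_mod_cast Real.cos_sq_add_sin_sq θ
  set a := pderiv 0 (pderiv 0 g) (polarPoint r θ)
  set b := pderiv 1 (pderiv 1 g) (polarPoint r θ)
  simp only [Complex.ofReal_mul, Complex.ofReal_neg]
  linear_combination (r : ℂ) ^ 2 * (a + b) * hcs + (r : ℂ) ^ 2 * hH

theorem integral_neg_linear_combination {f g h : ℝ → ℂ} {a b : ℝ} (hf : Continuous f)
    (hg : Continuous g) (hh : Continuous h) (A B C : ℂ) :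
    IntervalIntegrable (fun θ => -(A * f θ + B * g θ + C * h θ)) volume a b ∧
    ∫ θ in a..b, -(A * f θ + B * g θ + C * h θ) =
      -(A * (∫ θ in a..b, f θ) + B * (∫ θ in a..b, g θ) + C * ∫ θ in a..b, h θ) := by
  refine ⟨Continuous.intervalIntegrable (by fun_prop) _ _, ?_⟩
  rw [intervalIntegral.integral_neg,
    intervalIntegral.integral_add (Continuous.intervalIntegrable (by fun_prop) _ _)
      (Continuous.intervalIntegrable (by fun_prop) _ _),
    intervalIntegral.integral_add (Continuous.intervalIntegrable (by fun_prop) _ _)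
      (Continuous.intervalIntegrable (by fun_prop) _ _),
    intervalIntegral.integral_const_mul, intervalIntegral.integral_const_mul,
    intervalIntegral.integral_const_mul]

/-- Packs two integrations by parts into one antiderivative: (g_θ + in g)e^{-inθ} has derivative
(g_θθ + n²g)e^{-inθ}. -/
theorem hasDerivAt_angularDeriv_mul_angularChar {q : ℂ} {g : Plane → ℂ} (hg : ContDiff ℝ 2 g)
    {r θ : ℝ} (hH : HelmholtzAt q g (polarPoint r θ)) (n : ℤ) :
    HasDerivAt
      (fun s => (angularDeriv g r s + n * Complex.I * g (polarPoint r s)) * angularChar n s)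
      (-((r : ℂ) ^ 2 * (radialDerivTwo g r θ * angularChar n θ) +
        r * (radialDeriv g r θ * angularChar n θ) +
        (q * r ^ 2 - n ^ 2) * (g (polarPoint r θ) * angularChar n θ))) θ := by
  have h := ((hasDerivAt_angularDeriv hg hH).add
    ((hasDerivAt_angle (hg.of_le (by norm_num)) r θ).const_mul (n * Complex.I))).mul
      (hasDerivAt_angularChar n θ)
  refine h.congr_deriv ?_
  simp only [Pi.add_apply]
  linear_combination -(n : ℂ) ^ 2 * g (polarPoint r θ) * angularChar n θ * Complex.I_sq

/-- The angular modes of a solution of the Helmholtz equation solve Bessel's equation. -/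
theorem angularMode_bessel {q : ℂ} {g : Plane → ℂ} (hg : ContDiff ℝ 2 g) {r : ℝ}
    (hq : ∀ θ, HelmholtzAt q g (polarPoint r θ)) (n : ℤ) :
    (r : ℂ) ^ 2 * angularMode n (radialDerivTwo g) r + r * angularMode n (radialDeriv g) r +
      (q * r ^ 2 - n ^ 2) * angularMode n (fun r θ => g (polarPoint r θ)) r = 0 := by
  have hc := continuous_angularChar n
  have hθ : Continuous fun θ : ℝ => (r, θ) := by fun_prop
  have c0 : Continuous fun θ => g (polarPoint r θ) * angularChar n θ :=
    (hg.continuous.comp (continuous_polarPoint.comp hθ)).mul hc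
  have c1 : Continuous fun θ => radialDeriv g r θ * angularChar n θ :=
    ((continuous_radialDeriv (hg.of_le (by norm_num))).comp hθ).mul hc
  have c2 : Continuous fun θ => radialDerivTwo g r θ * angularChar n θ :=
    ((continuous_radialDerivTwo hg).comp hθ).mul hc
  obtain ⟨hint, hval⟩ := integral_neg_linear_combination (a := -Real.pi) (b := Real.pi) c2
    c1 c0 ((r : ℂ) ^ 2) r (q * r ^ 2 - n ^ 2)
  have hI := intervalIntegral.integral_eq_sub_of_hasDerivAt
    (fun θ _ => hasDerivAt_angularDeriv_mul_angularChar hg (hq θ) n) hint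
  have hper : angularDeriv g r Real.pi = angularDeriv g r (-Real.pi) := by
    simp [angularDeriv, polarPoint_pi]
  -- Periodicity cancels the boundary terms.
  rw [hper, polarPoint_pi, angularChar_pi, sub_self] at hI
  rw [hval, neg_eq_zero] at hI
  exact hI

/-! ### Uniqueness for Bessel's equation -/

theorem eq_zero_of_deriv_nonpos {G G' : ℝ → ℝ} {R : ℝ}
    (hG : ∀ r ∈ Ioo 0 R, HasDerivAt G (G' r) r) (hG' : ∀ r ∈ Ioo 0 R, G' r ≤ 0)
    (hpos : ∀ r ∈ Ioo 0 R, 0 ≤ G r) (hlim : Tendsto G (𝓝[>] 0) (𝓝 0)) {r : ℝ}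
    (hr : r ∈ Ioo 0 R) : G r = 0 := by
  have hanti : AntitoneOn G (Ioo 0 R) := by
    refine antitoneOn_of_deriv_nonpos (convex_Ioo 0 R)
      (fun s hs => (hG s hs).continuousAt.continuousWithinAt) ?_ ?_
    · rw [interior_Ioo]
      exact fun s hs => (hG s hs).differentiableAt.differentiableWithinAt
    · rw [interior_Ioo]
      exact fun s hs => by rw [(hG s hs).deriv]; exact hG' s hs
  refine le_antisymm (ge_of_tendsto hlim ?_) (hpos r hr)
  filter_upwards [Ioo_mem_nhdsGT hr.1] with s hs
  exact hanti ⟨hs.1, hs.2.trans hr.2⟩ hr hs.2.le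

theorem inner_le_half (z w : ℂ) : 2 * inner ℝ z w ≤ ‖z‖ ^ 2 + ‖w‖ ^ 2 := by
  nlinarith [real_inner_le_norm z w, sq_nonneg (‖z‖ - ‖w‖)]

theorem inner_mul_le (c z w : ℂ) : 2 * inner ℝ z (c * w) ≤ ‖c‖ * (‖z‖ ^ 2 + ‖w‖ ^ 2) := by
  have h := real_inner_le_norm z (c * w)
  rw [norm_mul] at h
  nlinarith [mul_nonneg (norm_nonneg c) (sq_nonneg (‖z‖ - ‖w‖))]

/-- A solution of Bessel's equation of order zero with vanishing Cauchy data at the singular point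
vanishes. -/
theorem bessel_zero_unique {q : ℂ} {M M₁ M₂ : ℝ → ℂ} {R : ℝ}
    (h0 : ∀ r, HasDerivAt M (M₁ r) r) (h1 : ∀ r, HasDerivAt M₁ (M₂ r) r)
    (hode : ∀ r ∈ Ioo 0 R, (r : ℂ) ^ 2 * M₂ r + r * M₁ r + q * r ^ 2 * M r = 0)
    (hM : M 0 = 0) (hM₁ : M₁ 0 = 0) {r : ℝ} (hr : r ∈ Ioo 0 R) : M r = 0 := by
  -- The energy E = |M|² + |M₁|² satisfies E' ≤ CE: the singular term -2|M₁|²/r has the good sign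
  -- and is dropped. So e^{-Cr}E is nonincreasing, and it tends to 0 at 0.
  set C := 1 + ‖q‖
  have hE : ∀ r, HasDerivAt (fun r => ‖M r‖ ^ 2 + ‖M₁ r‖ ^ 2)
      (2 * inner ℝ (M r) (M₁ r) + 2 * inner ℝ (M₁ r) (M₂ r)) r :=
    fun r => (h0 r).norm_sq.add (h1 r).norm_sq
  have hexp : ∀ r : ℝ, HasDerivAt (fun r => Real.exp (-C * r)) (Real.exp (-C * r) * (-C)) r :=
    fun r => by simpa using ((hasDerivAt_id r).const_mul (-C)).exp
  have hG := fun r => (hexp r).mul (hE r)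
  have key := eq_zero_of_deriv_nonpos (R := R) (fun r _ => hG r) ?_ ?_ ?_ hr
  · simp only [Pi.mul_apply, mul_eq_zero, Real.exp_ne_zero, false_or] at key
    have h2 : ‖M r‖ ^ 2 = 0 := by nlinarith [sq_nonneg ‖M r‖, sq_nonneg ‖M₁ r‖]
    simpa using h2
  · intro s hs
    have hs0 : (s : ℂ) ≠ 0 := by exact_mod_cast hs.1.ne'
    have h2 : M₂ s = ((-s⁻¹ : ℝ) : ℂ) * M₁ s + (-q) * M s := by
      have := hode s hs
      push_cast
      field_simp
      have h3 : (s : ℂ) * (s * M₂ s + M₁ s + q * s * M s) = 0 := by linear_combination this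
      have h4 := (mul_eq_zero.mp h3).resolve_left hs0
      linear_combination h4
    have h3 : inner ℝ (M₁ s) (M₂ s) = -s⁻¹ * ‖M₁ s‖ ^ 2 + inner ℝ (M₁ s) ((-q) * M s) := by
      rw [h2, inner_add_right, ← Complex.real_smul, inner_smul_right, real_inner_self_eq_norm_sq]
    have h4 : 0 ≤ s⁻¹ * ‖M₁ s‖ ^ 2 := mul_nonneg (inv_nonneg.mpr hs.1.le) (sq_nonneg _)
    have h5 := inner_mul_le (-q) (M₁ s) (M s)
    have h6 := inner_le_half (M s) (M₁ s)
    rw [norm_neg] at h5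
    have h7 : 2 * inner ℝ (M s) (M₁ s) + 2 * inner ℝ (M₁ s) (M₂ s) ≤
        C * (‖M s‖ ^ 2 + ‖M₁ s‖ ^ 2) := by
      rw [h3]; simp only [C]; linarith
    nlinarith [mul_le_mul_of_nonneg_left h7 (Real.exp_pos (-C * s)).le]
  · exact fun s _ => mul_nonneg (Real.exp_pos _).le (by positivity)
  · have h2 := (hG 0).continuousAt.tendsto
    have h3 : ((fun r => Real.exp (-C * r)) * fun r => ‖M r‖ ^ 2 + ‖M₁ r‖ ^ 2) 0 = 0 := by
      simp [hM, hM₁]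
    rw [h3] at h2
    exact h2.mono_left nhdsWithin_le_nhds

/-- A solution of Bessel's equation that vanishes to infinite order at the singular point
vanishes. -/
theorem bessel_flat_unique {q : ℂ} {n : ℤ} {M M₁ M₂ : ℝ → ℂ} {R : ℝ}
    (h0 : ∀ r, HasDerivAt M (M₁ r) r) (h1 : ∀ r, HasDerivAt M₁ (M₂ r) r)
    (hode : ∀ r ∈ Ioo 0 R, (r : ℂ) ^ 2 * M₂ r + r * M₁ r + (q * r ^ 2 - n ^ 2) * M r = 0)
    (hflat : ∀ N : ℕ, ∃ K, ∀ᶠ r in 𝓝[>] (0 : ℝ), ‖M r‖ ≤ K * r ^ N ∧ ‖M₁ r‖ ≤ K * r ^ N)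
    {r : ℝ} (hr : r ∈ Ioo 0 R) : M r = 0 := by
  -- With E = |M|² + |rM₁|², this N gives rE' ≤ NE on (0, R), so E/rᴺ is nonincreasing; flatness
  -- makes its limit at 0 vanish.
  obtain ⟨N, hN⟩ := exists_nat_ge (1 + (‖q‖ * R ^ 2 + ‖(n : ℂ)‖ ^ 2))
  have hB : ∀ r : ℝ, HasDerivAt (fun r : ℝ => (r : ℂ) * M₁ r) (M₁ r + r * M₂ r) r := fun r => by
    have h := (hasDerivAt_id r).ofReal_comp.mul (h1 r)
    simp only [Complex.ofReal_one, one_mul] at h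
    exact h
  have hE : ∀ r, HasDerivAt (fun r : ℝ => ‖M r‖ ^ 2 + ‖(r : ℂ) * M₁ r‖ ^ 2)
      (2 * inner ℝ (M r) (M₁ r) + 2 * inner ℝ ((r : ℂ) * M₁ r) (M₁ r + r * M₂ r)) r :=
    fun r => (h0 r).norm_sq.add (hB r).norm_sq
  have hG : ∀ r ∈ Ioo 0 R, _ :=
    fun r (hr : r ∈ Ioo 0 R) => (hE r).div (hasDerivAt_pow N r) (pow_ne_zero N hr.1.ne')
  have key := eq_zero_of_deriv_nonpos hG ?_ ?_ ?_ hr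
  · simp only [Pi.div_apply, div_eq_zero_iff, pow_ne_zero N hr.1.ne', or_false] at key
    have h2 : ‖M r‖ ^ 2 = 0 := by nlinarith [sq_nonneg ‖M r‖, sq_nonneg ‖(r : ℂ) * M₁ r‖]
    simpa using h2
  · intro s hs
    refine div_nonpos_of_nonpos_of_nonneg ?_ (sq_nonneg _)
    set B := (s : ℂ) * M₁ s with hBdef
    have hsB : s * inner ℝ (M s) (M₁ s) = inner ℝ (M s) B := by
      rw [hBdef, ← Complex.real_smul, inner_smul_right]
    have hsB' : s * inner ℝ B (M₁ s + s * M₂ s) =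
        inner ℝ B (-(q * s ^ 2 - n ^ 2) * M s) := by
      have h2 : -(q * s ^ 2 - n ^ 2) * M s = s • (M₁ s + s * M₂ s) := by
        rw [Complex.real_smul]
        linear_combination -(hode s hs)
      rw [h2, inner_smul_right]
    have h3 := inner_mul_le (-(q * s ^ 2 - n ^ 2)) B (M s)
    have h4 := inner_le_half (M s) B
    have h5 : ‖-(q * (s : ℂ) ^ 2 - n ^ 2)‖ ≤ ‖q‖ * R ^ 2 + ‖(n : ℂ)‖ ^ 2 := by
      rw [norm_neg]
      refine (norm_sub_le _ _).trans (add_le_add ?_ (norm_pow _ _).le)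
      rw [norm_mul, norm_pow, Complex.norm_real, Real.norm_eq_abs, abs_of_pos hs.1]
      gcongr
      · exact hs.1.le
      · exact hs.2.le
    set E := ‖M s‖ ^ 2 + ‖B‖ ^ 2 with hEdef
    have hE0 : 0 ≤ E := by positivity
    have h6 : s * (2 * inner ℝ (M s) (M₁ s) + 2 * inner ℝ B (M₁ s + s * M₂ s)) ≤ N * E := by
      have h7 : ‖-(q * (s : ℂ) ^ 2 - n ^ 2)‖ * (‖B‖ ^ 2 + ‖M s‖ ^ 2) ≤
          (‖q‖ * R ^ 2 + ‖(n : ℂ)‖ ^ 2) * E := by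
        rw [add_comm (‖B‖ ^ 2)]; exact mul_le_mul_of_nonneg_right h5 hE0
      have h8 := mul_le_mul_of_nonneg_right hN hE0
      linarith
    -- The derivative of the power contains the truncated exponent `N - 1`, so N = 0 is separated.
    rcases Nat.eq_zero_or_pos N with rfl | hNpos
    · have h7 : s * (2 * inner ℝ (M s) (M₁ s) + 2 * inner ℝ B (M₁ s + s * M₂ s)) ≤ 0 := by
        simpa using h6
      have := nonpos_of_mul_nonpos_right h7 hs.1
      simpa using this
    · obtain ⟨k, rfl⟩ := Nat.exists_eq_succ_of_ne_zero hNpos.ne'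
      have h7 := mul_le_mul_of_nonneg_right h6 (pow_nonneg hs.1.le k)
      simp only [Nat.succ_eq_add_one, Nat.add_sub_cancel] at h7 ⊢
      rw [pow_succ]
      linarith
  · exact fun s hs => div_nonneg (by positivity) (pow_nonneg hs.1.le _)
  · obtain ⟨K, hK⟩ := hflat (N + 1)
    have hlim : Tendsto (fun s : ℝ => 2 * K ^ 2 * s) (𝓝[>] 0) (𝓝 0) := by
      have : Tendsto (fun s : ℝ => 2 * K ^ 2 * s) (𝓝 0) (𝓝 (2 * K ^ 2 * 0)) :=
        (continuous_const.mul continuous_id).tendsto 0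
      rw [mul_zero] at this
      exact this.mono_left nhdsWithin_le_nhds
    refine squeeze_zero' ?_ ?_ hlim
    · filter_upwards [self_mem_nhdsWithin] with s hs
      exact div_nonneg (by positivity) (pow_nonneg (le_of_lt hs) _)
    · filter_upwards [hK, Ioo_mem_nhdsGT one_pos] with s hs hs1
      have hsN : 0 < s ^ N := pow_pos hs1.1 N
      have hsN1 : s ^ N ≤ 1 := pow_le_one₀ hs1.1.le hs1.2.le
      have hsN' : (s ^ (N + 1)) ^ 2 ≤ s * s ^ N := by
        have : s ^ (N + 1) ≤ 1 := pow_le_one₀ hs1.1.le hs1.2.le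
        have h3 : 0 ≤ s ^ (N + 1) := pow_nonneg hs1.1.le _
        calc (s ^ (N + 1)) ^ 2 ≤ s ^ (N + 1) := by nlinarith
          _ = s * s ^ N := by ring
      have hA : ‖M s‖ ^ 2 ≤ K ^ 2 * (s ^ (N + 1)) ^ 2 := by
        rw [← mul_pow]; gcongr; exact hs.1
      have hB2 : ‖M₁ s‖ ^ 2 ≤ K ^ 2 * (s ^ (N + 1)) ^ 2 := by
        rw [← mul_pow]; gcongr; exact hs.2
      have hB3 : ‖(s : ℂ) * M₁ s‖ ^ 2 ≤ ‖M₁ s‖ ^ 2 := by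
        rw [norm_mul, Complex.norm_real, Real.norm_eq_abs, abs_of_pos hs1.1]
        exact pow_le_pow_left₀ (mul_nonneg hs1.1.le (norm_nonneg _))
          (mul_le_of_le_one_left (norm_nonneg _) hs1.2.le) 2
      rw [Pi.div_apply, div_le_iff₀ hsN]
      nlinarith [mul_le_mul_of_nonneg_left hsN' (sq_nonneg K)]

/-! ### Consequences for the Helmholtz equation -/

/-- Mean value property in homogeneous form. The circle integral is the mode n = 0; at r = 0 it
vanishes with g, and its derivative vanishes because cos and sin have mean zero. -/
theorem integral_polarPoint_eq_zero {q : ℂ} {g : Plane → ℂ} {R : ℝ} (hg : ContDiff ℝ 2 g)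
    (hq : ∀ x, ‖x‖ < R → HelmholtzAt q g x) (h0 : g 0 = 0) {r : ℝ} (hr : r ∈ Ioo 0 R) :
    ∫ θ in (-Real.pi)..Real.pi, g (polarPoint r θ) = 0 := by
  have hg1 : ContDiff ℝ 1 g := hg.of_le (by norm_num)
  have hz : ∀ θ, polarPoint 0 θ = 0 := fun θ => by rw [← norm_eq_zero, norm_polarPoint, abs_zero]
  have h := bessel_zero_unique (q := q) (R := R) (M := angularMode 0 fun r θ => g (polarPoint r θ))
    (hasDerivAt_angularMode 0 (hg.continuous.comp continuous_polarPoint)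
      (continuous_radialDeriv hg1) (hasDerivAt_radius hg1))
    (hasDerivAt_angularMode 0 (continuous_radialDeriv hg1) (continuous_radialDerivTwo hg)
      (hasDerivAt_radialDeriv hg))
    (fun s hs => by
      have := angularMode_bessel hg (r := s) (fun θ => hq _ (by
        rw [norm_polarPoint, abs_of_pos hs.1]; exact hs.2)) 0
      simpa using this)
    (by simp [angularMode, hz, h0])
    (by
      simp only [angularMode, radialDeriv, hz, angularChar]
      simp only [Int.cast_zero, zero_mul, neg_zero, Complex.exp_zero, mul_one]
      rw [intervalIntegral.integral_add (Continuous.intervalIntegrable (by fun_prop) _ _)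
        (Continuous.intervalIntegrable (by fun_prop) _ _), intervalIntegral.integral_mul_const,
        intervalIntegral.integral_mul_const, intervalIntegral.integral_ofReal,
        intervalIntegral.integral_ofReal]
      simp) hr
  simpa [angularMode, angularChar] using h

/-- Zero Fourier coefficients are summable, so the Fourier series converges pointwise to P. -/
theorem eq_zero_of_angularChar_integral_eq_zero {P : ℝ → ℂ} (hP : Continuous P)
    (hper : P Real.pi = P (-Real.pi))
    (h : ∀ n, ∫ θ in (-Real.pi)..Real.pi, P θ * angularChar n θ = 0) {θ : ℝ}
    (hθ : θ ∈ Ico (-Real.pi) Real.pi) : P θ = 0 := by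
  have hpi := Real.pi_pos
  have : Fact (0 < Real.pi - -Real.pi) := ⟨by linarith⟩
  have hab : -Real.pi + (Real.pi - -Real.pi) = Real.pi := by ring
  have hc : Continuous (AddCircle.liftIco (Real.pi - -Real.pi) (-Real.pi) P) :=
    AddCircle.liftIco_continuous (by rw [hab, hper]) hP.continuousOn
  have hcoef : fourierCoeff (AddCircle.liftIco (Real.pi - -Real.pi) (-Real.pi) P) = 0 := by
    funext n
    rw [fourierCoeff_eq_intervalIntegral _ n (-Real.pi), hab]
    have : ∫ x in (-Real.pi)..Real.pi, fourier (-n) (x : AddCircle (Real.pi - -Real.pi)) •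
        AddCircle.liftIco (Real.pi - -Real.pi) (-Real.pi) P x =
        ∫ x in (-Real.pi)..Real.pi, P x * angularChar n x := by
      rw [intervalIntegral.integral_of_le (by linarith), intervalIntegral.integral_of_le (by linarith),
        ← integral_Ico_eq_integral_Ioc, ← integral_Ico_eq_integral_Ioc]
      refine setIntegral_congr_fun measurableSet_Ico fun x hx => ?_
      rw [AddCircle.liftIco_coe_apply (by rwa [hab]), smul_eq_mul, mul_comm, fourier_coe_apply]
      congr 2
      have : (Real.pi : ℂ) ≠ 0 := by exact_mod_cast Real.pi_ne_zero
      push_cast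
      field_simp
      ring
    rw [this, h n, smul_zero, Pi.zero_apply]
  have hs := has_pointwise_sum_fourier_series_of_summable (f := ⟨_, hc⟩)
    (by simp only [ContinuousMap.coe_mk, hcoef]; exact summable_zero) (θ : AddCircle _)
  simp only [ContinuousMap.coe_mk, hcoef, Pi.zero_apply, zero_smul] at hs
  rw [← AddCircle.liftIco_coe_apply (p := Real.pi - -Real.pi) (f := P) (by rwa [hab])]
  exact hs.unique hasSum_zero

theorem exists_polarPoint_eq (x : Plane) : ∃ θ ∈ Ico (-Real.pi) Real.pi, polarPoint ‖x‖ θ = x := by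
  set z : ℂ := ⟨x 0, x 1⟩
  have hz : ‖z‖ = ‖x‖ := by
    rw [EuclideanSpace.norm_eq, Complex.norm_eq_sqrt_sq_add_sq, Fin.sum_univ_two]
    simp [z]
  have hx : polarPoint ‖x‖ z.arg = x := by
    ext i
    fin_cases i
    · simp [← hz, Complex.norm_mul_cos_arg, z]
    · simp [← hz, Complex.norm_mul_sin_arg, z]
  rcases eq_or_ne z.arg Real.pi with h | h
  · exact ⟨-Real.pi, ⟨le_rfl, by linarith [Real.pi_pos]⟩, by rw [← polarPoint_pi, ← h, hx]⟩
  · exact ⟨z.arg, ⟨(Complex.neg_pi_lt_arg z).le, lt_of_le_of_ne (Complex.arg_le_pi z) h⟩, hx⟩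

theorem norm_angularMode_le {P : ℝ → ℝ → ℂ} {r K : ℝ} (h : ∀ θ, ‖P r θ‖ ≤ K) (n : ℤ) :
    ‖angularMode n P r‖ ≤ K * (2 * Real.pi) := by
  have := intervalIntegral.norm_integral_le_of_norm_le_const (a := -Real.pi) (b := Real.pi)
    (f := fun θ => P r θ * angularChar n θ) (C := K)
    (fun θ _ => by rw [norm_mul, norm_angularChar, mul_one]; exact h θ)
  rw [abs_of_nonneg (by linarith [Real.pi_pos])] at this
  unfold angularMode
  linarith

/-- Strong unique continuation for the Helmholtz equation. -/
theorem eq_zero_of_flat {q : ℂ} {g : Plane → ℂ} {R : ℝ} (hg : ContDiff ℝ 2 g)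
    (hq : ∀ x, ‖x‖ < R → HelmholtzAt q g x)
    (hflat : ∀ N : ℕ, ∃ K, ∀ᶠ x in 𝓝 (0 : Plane), ‖g x‖ ≤ K * ‖x‖ ^ N ∧
      ∀ j, ‖pderiv j g x‖ ≤ K * ‖x‖ ^ N) {x : Plane} (hx : ‖x‖ < R) : g x = 0 := by
  have hg1 : ContDiff ℝ 1 g := hg.of_le (by norm_num)
  by_cases hx0 : x = 0
  · obtain ⟨K, hK⟩ := hflat 1
    have := hK.self_of_nhds.1
    simpa [hx0] using this
  have hxpos : 0 < ‖x‖ := norm_pos_iff.mpr hx0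
  have hmode : ∀ n, angularMode n (fun r θ => g (polarPoint r θ)) ‖x‖ = 0 := by
    intro n
    refine bessel_flat_unique (q := q) (n := n) (R := R)
      (hasDerivAt_angularMode n (hg.continuous.comp continuous_polarPoint)
        (continuous_radialDeriv hg1) (hasDerivAt_radius hg1))
      (hasDerivAt_angularMode n (continuous_radialDeriv hg1) (continuous_radialDerivTwo hg)
        (hasDerivAt_radialDeriv hg))
      (fun s hs => angularMode_bessel hg (r := s) (fun θ => hq _ (by
        rw [norm_polarPoint, abs_of_pos hs.1]; exact hs.2)) n) (fun N => ?_) ⟨hxpos, hx⟩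
    obtain ⟨K, hK⟩ := hflat N
    obtain ⟨ε, hε, hball⟩ := Metric.eventually_nhds_iff_ball.mp hK
    refine ⟨2 * K * (2 * Real.pi), ?_⟩
    filter_upwards [Ioo_mem_nhdsGT hε] with r hr
    have hn : ∀ θ, ‖polarPoint r θ‖ = r := fun θ => by rw [norm_polarPoint, abs_of_pos hr.1]
    have hb : ∀ θ, ‖g (polarPoint r θ)‖ ≤ K * r ^ N ∧
        ∀ j, ‖pderiv j g (polarPoint r θ)‖ ≤ K * r ^ N := fun θ => by
      have := hball (polarPoint r θ) (by rw [mem_ball_zero_iff, hn]; exact hr.2)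
      rwa [hn] at this
    have hK0 : 0 ≤ K * r ^ N := (norm_nonneg _).trans (hb 0).1
    constructor
    · have := norm_angularMode_le (P := fun r θ => g (polarPoint r θ)) (r := r)
        (K := 2 * (K * r ^ N)) (fun θ => (hb θ).1.trans (by linarith)) n
      linarith
    · have := norm_angularMode_le (P := radialDeriv g) (r := r) (K := 2 * (K * r ^ N))
        (fun θ => by
          refine (norm_add_le _ _).trans ?_
          rw [norm_mul, norm_mul, Complex.norm_real, Complex.norm_real, Real.norm_eq_abs,
            Real.norm_eq_abs]
          have h1 := mul_le_mul (Real.abs_cos_le_one θ) ((hb θ).2 0) (norm_nonneg _) zero_le_one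
          have h2 := mul_le_mul (Real.abs_sin_le_one θ) ((hb θ).2 1) (norm_nonneg _) zero_le_one
          linarith) n
      linarith
  obtain ⟨θ, hθ, hxθ⟩ := exists_polarPoint_eq x
  rw [← hxθ]
  exact eq_zero_of_angularChar_integral_eq_zero (P := fun θ => g (polarPoint ‖x‖ θ))
    (hg.continuous.comp (continuous_polarPoint.comp (by fun_prop : Continuous fun θ => (‖x‖, θ))))
    (by rw [polarPoint_pi]) hmode hθ

/-! ### Interior regularity for the Helmholtz equation -/

theorem integral_eq_zero_of_polar {F : Plane → ℂ}
    (h : ∀ r > 0, ∫ θ in (-Real.pi)..Real.pi, F (polarPoint r θ) = 0) : ∫ x, F x = 0 := by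
  have he := Complex.orthonormalBasisOneI.measurePreserving_repr
  rw [← he.integral_comp Complex.orthonormalBasisOneI.repr.toHomeomorph.measurableEmbedding,
    ← Complex.integral_comp_polarCoord_symm]
  have heq : ∀ p : ℝ × ℝ, Complex.orthonormalBasisOneI.repr (Complex.polarCoord.symm p) =
      polarPoint p.1 p.2 := fun p => by
    rw [Complex.polarCoord_symm_apply]
    ext i
    fin_cases i <;> simp [Complex.orthonormalBasisOneI_repr_apply, Complex.cos_ofReal_re,
      Complex.sin_ofReal_re]
  simp only [heq]
  -- Without integrability the integral is 0 by convention, so no such hypothesis on F is required.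
  by_cases hi : IntegrableOn (fun p : ℝ × ℝ => p.1 • F (polarPoint p.1 p.2)) polarCoord.target
  · rw [polarCoord_target] at hi ⊢
    rw [Measure.volume_eq_prod] at hi ⊢
    rw [setIntegral_prod _ hi]
    refine setIntegral_eq_zero_of_forall_eq_zero fun r hr => ?_
    simp only
    rw [integral_smul, ← integral_Ioc_eq_integral_Ioo, ← intervalIntegral.integral_of_le
      (by linarith [Real.pi_pos]), h r hr, smul_zero]
  · exact integral_undef hi

theorem pderiv_eq_of_hasDerivAt_line {f : Plane → ℂ} {x : Plane} {j : Fin 2} {c : ℂ}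
    (hf : DifferentiableAt ℝ f x)
    (h : HasDerivAt (fun t : ℝ => f (x + t • EuclideanSpace.single j (1 : ℝ))) c 0) :
    pderiv j f x = c := by
  have h1 := hf.lineDeriv_eq_fderiv (v := EuclideanSpace.single j (1 : ℝ))
  rw [pderiv, ← h1]
  exact h.deriv

/-- The plane wave `e^{c x₁}`. -/
noncomputable def planeWave (c : ℂ) (x : Plane) : ℂ := Complex.exp (c * (x 0 : ℂ))

theorem contDiff_planeWave (c : ℂ) {n : WithTop ℕ∞} : ContDiff ℝ n (planeWave c) := by
  have h0 : ContDiff ℝ n fun x : Plane => x 0 := (EuclideanSpace.proj (𝕜 := ℝ) (0 : Fin 2)).contDiff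
  exact (contDiff_const.mul (Complex.ofRealCLM.contDiff.comp h0)).cexp

theorem pderiv_zero_planeWave (c : ℂ) : pderiv 0 (planeWave c) = fun x => c * planeWave c x := by
  funext x
  refine pderiv_eq_of_hasDerivAt_line ((contDiff_planeWave c (n := 1)).differentiable one_ne_zero x) ?_
  have h : HasDerivAt (fun t : ℝ => c * (((x 0 + t : ℝ)) : ℂ)) c 0 := by
    have := ((hasDerivAt_id (0 : ℝ)).const_add (x 0)).ofReal_comp.const_mul c
    simp only [Complex.ofReal_one, mul_one] at this
    exact this
  have := h.cexp
  rw [add_zero, mul_comm] at this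
  simpa [planeWave] using this

theorem pderiv_one_planeWave (c : ℂ) : pderiv 1 (planeWave c) = fun _ => 0 := by
  funext x
  refine pderiv_eq_of_hasDerivAt_line ((contDiff_planeWave c (n := 1)).differentiable one_ne_zero x) ?_
  simpa [planeWave] using hasDerivAt_const (0 : ℝ) (Complex.exp (c * (x 0 : ℂ)))

theorem pderiv_const_mul {f : Plane → ℂ} (hf : Differentiable ℝ f) (c : ℂ) (j : Fin 2) :
    pderiv j (fun x => c * f x) = fun x => c * pderiv j f x := by
  funext x
  rw [pderiv, fderiv_const_mul (hf x)]
  simp [pderiv]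

theorem pderiv_sub {f g : Plane → ℂ} (hf : Differentiable ℝ f) (hg : Differentiable ℝ g)
    (j : Fin 2) : pderiv j (fun x => f x - g x) = fun x => pderiv j f x - pderiv j g x := by
  funext x
  rw [pderiv, fderiv_fun_sub (hf x) (hg x)]
  simp [pderiv]

theorem pderiv_add {f g : Plane → ℂ} (hf : Differentiable ℝ f) (hg : Differentiable ℝ g)
    (j : Fin 2) : pderiv j (fun x => f x + g x) = fun x => pderiv j f x + pderiv j g x := by
  funext x
  rw [pderiv, fderiv_fun_add (hf x) (hg x)]
  simp [pderiv]

theorem pderiv_comp_const_sub {f : Plane → ℂ} (hf : Differentiable ℝ f) (a : Plane) (j : Fin 2) :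
    pderiv j (fun x => f (a - x)) = fun x => -1 * pderiv j f (a - x) := by
  funext x
  have h : HasFDerivAt (fun y : Plane => f (a - y)) ((fderiv ℝ f (a - x)).comp
      (-ContinuousLinearMap.id ℝ Plane)) x :=
    (hf (a - x)).hasFDerivAt.comp x ((hasFDerivAt_id x).const_sub a)
  rw [pderiv, h.fderiv]
  simp [pderiv]

theorem HelmholtzAt.sub {q : ℂ} {f g : Plane → ℂ} (hf : ContDiff ℝ 2 f) (hg : ContDiff ℝ 2 g)
    {x : Plane} (hx : HelmholtzAt q f x) (hx' : HelmholtzAt q g x) :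
    HelmholtzAt q (fun y => f y - g y) x := by
  unfold HelmholtzAt at *
  have hd : ∀ j, Differentiable ℝ (pderiv j f) := fun j =>
    (contDiff_pderiv (m := 1) hf (by norm_num) j).differentiable one_ne_zero
  have hd' : ∀ j, Differentiable ℝ (pderiv j g) := fun j =>
    (contDiff_pderiv (m := 1) hg (by norm_num) j).differentiable one_ne_zero
  simp only [pderiv_sub (hf.differentiable two_ne_zero) (hg.differentiable two_ne_zero),
    pderiv_sub (hd _) (hd' _)]
  linear_combination hx - hx'

theorem HelmholtzAt.const_mul {q : ℂ} {f : Plane → ℂ} (hf : ContDiff ℝ 2 f) (c : ℂ)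
    {x : Plane} (hx : HelmholtzAt q f x) : HelmholtzAt q (fun y => c * f y) x := by
  unfold HelmholtzAt at *
  have hd : ∀ j, Differentiable ℝ (pderiv j f) := fun j =>
    (contDiff_pderiv (m := 1) hf (by norm_num) j).differentiable one_ne_zero
  simp only [pderiv_const_mul (hf.differentiable two_ne_zero), pderiv_const_mul (hd _)]
  linear_combination c * hx

theorem HelmholtzAt.comp_const_sub {q : ℂ} {f : Plane → ℂ} (hf : ContDiff ℝ 2 f) {a x : Plane}
    (hx : HelmholtzAt q f (a - x)) : HelmholtzAt q (fun y => f (a - y)) x := by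
  unfold HelmholtzAt at *
  have hd : ∀ j, Differentiable ℝ (pderiv j f) := fun j =>
    (contDiff_pderiv (m := 1) hf (by norm_num) j).differentiable one_ne_zero
  have hd' : ∀ j, Differentiable ℝ (fun y => pderiv j f (a - y)) := fun j =>
    (hd j).comp (differentiable_id.const_sub a)
  simp only [pderiv_comp_const_sub (hf.differentiable two_ne_zero), pderiv_const_mul (hd' _),
    pderiv_comp_const_sub (hd _)]
  linear_combination hx

theorem helmholtzAt_planeWave {q c : ℂ} (h : c ^ 2 = -q) (x : Plane) :
    HelmholtzAt q (planeWave c) x := by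
  unfold HelmholtzAt
  rw [pderiv_one_planeWave, pderiv_zero_planeWave,
    pderiv_const_mul ((contDiff_planeWave c (n := 1)).differentiable one_ne_zero),
    pderiv_zero_planeWave]
  have : pderiv 1 (fun _ : Plane => (0 : ℂ)) x = 0 := by simp [pderiv]
  rw [this]
  linear_combination planeWave c x * h

/-- A radial bump function supported in the ball of radius `ε`. -/
noncomputable def radialBump (ε : ℝ) (x : Plane) : ℝ := Real.smoothTransition (ε ^ 2 - ‖x‖ ^ 2)

theorem contDiff_radialBump (ε : ℝ) {n : ℕ∞} : ContDiff ℝ n (radialBump ε) :=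
  Real.smoothTransition.contDiff.comp (contDiff_const.sub (contDiff_norm_sq ℝ))

theorem radialBump_eq_zero {ε : ℝ} (hε : 0 < ε) {x : Plane} (hx : ε ≤ ‖x‖) :
    radialBump ε x = 0 :=
  Real.smoothTransition.zero_of_nonpos (by nlinarith)

theorem hasCompactSupport_radialBump {ε : ℝ} (hε : 0 < ε) : HasCompactSupport (radialBump ε) := by
  refine HasCompactSupport.intro (isCompact_closedBall 0 ε) fun x hx => ?_
  rw [mem_closedBall_zero_iff, not_le] at hx
  exact radialBump_eq_zero hε hx.le

/-- A solution of the Helmholtz equation near the origin agrees near the origin with a smooth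
function. -/
theorem exists_contDiff_eventuallyEq {q : ℂ} {u : Plane → ℂ} {R : ℝ} (hR : 0 < R)
    (hu : ContDiff ℝ 2 u) (hq : ∀ x, ‖x‖ < R → HelmholtzAt q u x) :
    ∃ U : Plane → ℂ, ContDiff ℝ ∞ U ∧ u =ᶠ[𝓝 0] U := by
  -- The plane wave w = e^{cx₁} solves the same equation and w(0) = 1. Hence y ↦ u(x-y) - u(x)w(y)
  -- vanishes at 0 and has zero circle integrals; integrating against a radial bump φ gives φ⋆u = Cu
  -- near 0 with C = ∫φw, so u inherits the smoothness of φ.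
  obtain ⟨c, hc⟩ := IsSquare.exists_sq (-q) (Complex.isSquare (-q))
  have hw : ContDiff ℝ 2 (planeWave c) := contDiff_planeWave c
  have hre : Continuous fun x => (planeWave c x).re := Complex.continuous_re.comp hw.continuous
  have hw0 : planeWave c 0 = 1 := by simp [planeWave]
  obtain ⟨δ, hδ, hpos⟩ := Metric.eventually_nhds_iff_ball.mp
    (hre.continuousAt.eventually (lt_mem_nhds (a := 0) (b := (planeWave c 0).re) (by simp [hw0])))
  -- The bound δ keeps Re w positive where φ lives, so C ≠ 0; the bound R/2 keeps x - y in the ball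
  -- of radius R when |x| < R/2.
  obtain ⟨ε, hε, hεδ, hεR⟩ : ∃ ε, 0 < ε ∧ ε ≤ δ ∧ ε ≤ R / 2 :=
    ⟨min δ (R / 2), by positivity, min_le_left _ _, min_le_right _ _⟩
  have hφ : Continuous (radialBump ε) := (contDiff_radialBump ε (n := 0)).continuous
  have hφs := hasCompactSupport_radialBump hε
  have hint : ∀ F : Plane → ℂ, Continuous F → Integrable fun t => radialBump ε t • F t :=
    fun F hF => (hφ.smul hF).integrable_of_hasCompactSupport hφs.smul_right
  set C : ℂ := ∫ t, radialBump ε t • planeWave c t with hC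
  have hC0 : C ≠ 0 := by
    have hCre : C.re = ∫ t, radialBump ε t * (planeWave c t).re := by
      rw [hC, ← Complex.reCLM_apply, ← Complex.reCLM.integral_comp_comm (hint _ hw.continuous)]
      simp
    have : 0 < C.re := by
      rw [hCre]
      refine (hφ.mul hre).integral_pos_of_hasCompactSupport_nonneg_nonzero hφs.mul_right
        (fun t => ?_) (x := 0) ?_
      · rcases lt_or_ge ‖t‖ ε with h | h
        · exact mul_nonneg (Real.smoothTransition.nonneg _)
            (hpos t (by rw [mem_ball_zero_iff]; linarith)).le
        · simp [radialBump_eq_zero hε h]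
      · have : 0 < radialBump ε 0 := Real.smoothTransition.pos_of_pos (by simp; positivity)
        simp [hw0, this.ne']
    intro h
    simp [h] at this
  refine ⟨fun x => C⁻¹ * (radialBump ε ⋆[ContinuousLinearMap.lsmul ℝ ℝ, volume] u) x,
    contDiff_const.mul (hφs.contDiff_convolution_left _ (contDiff_radialBump ε)
      hu.continuous.locallyIntegrable), ?_⟩
  filter_upwards [Metric.ball_mem_nhds (0 : Plane) (half_pos hR)] with x hx
  rw [mem_ball_zero_iff] at hx
  have hux : ContDiff ℝ 2 fun y => u (x - y) := hu.comp (contDiff_const.sub contDiff_id)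
  have hwx : ContDiff ℝ 2 fun y => u x * planeWave c y := contDiff_const.mul hw
  have hmean : ∀ r > 0, ∫ θ in (-Real.pi)..Real.pi, radialBump ε (polarPoint r θ) •
      (u (x - polarPoint r θ) - u x * planeWave c (polarPoint r θ)) = 0 := by
    intro r hr
    have hrad : ∀ θ, radialBump ε (polarPoint r θ) = Real.smoothTransition (ε ^ 2 - r ^ 2) :=
      fun θ => by rw [radialBump, norm_polarPoint, sq_abs]
    simp only [hrad]
    rw [intervalIntegral.integral_smul]
    rcases lt_or_ge r ε with h | h
    · rw [integral_polarPoint_eq_zero (q := q) (R := R / 2) (hux.sub hwx) (fun y hy =>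
        HelmholtzAt.sub hux hwx (HelmholtzAt.comp_const_sub hu (hq _ ?_))
          (HelmholtzAt.const_mul hw _ (helmholtzAt_planeWave hc.symm y)))
        (by simp [hw0]) ⟨hr, by linarith⟩, smul_zero]
      linarith [norm_sub_le x y]
    · rw [Real.smoothTransition.zero_of_nonpos (by nlinarith), zero_smul]
  have h0 := integral_eq_zero_of_polar
    (F := fun y => radialBump ε y • (u (x - y) - u x * planeWave c y)) hmean
  simp only [smul_sub] at h0
  rw [integral_sub (hint _ hux.continuous) (hint _ hwx.continuous), sub_eq_zero] at h0
  have h1 : ∫ t, radialBump ε t • (u x * planeWave c t) = u x * C := by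
    rw [hC, ← integral_const_mul]
    congr 1; funext t; rw [mul_smul_comm]
  rw [h1] at h0
  rw [convolution_def]
  simp only [ContinuousLinearMap.lsmul_apply]
  rw [h0]
  field_simp

/-! ### Iterated partial derivatives of smooth functions -/

theorem contDiff_pderiv_top {f : Plane → ℂ} (hf : ContDiff ℝ ∞ f) (j : Fin 2) :
    ContDiff ℝ ∞ (pderiv j f) :=
  contDiff_pderiv hf (by norm_num) j

theorem contDiff_pderiv_iterate {f : Plane → ℂ} (hf : ContDiff ℝ ∞ f) (j : Fin 2) (n : ℕ) :
    ContDiff ℝ ∞ ((pderiv j)^[n] f) := by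
  induction n generalizing f with
  | zero => exact hf
  | succ n ih => exact ih (contDiff_pderiv_top hf j)

theorem pderiv_iterate_comm {f : Plane → ℂ} (hf : ContDiff ℝ ∞ f) (i j : Fin 2) (n : ℕ) :
    (pderiv j)^[n] (pderiv i f) = pderiv i ((pderiv j)^[n] f) := by
  induction n generalizing f with
  | zero => rfl
  | succ n ih =>
    rw [Function.iterate_succ_apply, pderiv_comm (hf.of_le ENat.LEInfty.out) j i,
      ih (contDiff_pderiv_top hf j), Function.iterate_succ_apply]

theorem pderiv_iterate_congr {f g : Plane → ℂ} {x : Plane} (h : f =ᶠ[𝓝 x] g) (j : Fin 2) (n : ℕ) :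
    (pderiv j)^[n] f =ᶠ[𝓝 x] (pderiv j)^[n] g := by
  induction n generalizing f g with
  | zero => exact h
  | succ n ih => exact ih (pderiv_congr h j)

theorem pderiv_iterate_linear {f g : Plane → ℂ} (hf : ContDiff ℝ ∞ f) (hg : ContDiff ℝ ∞ g)
    (a b : ℂ) (j : Fin 2) (n : ℕ) :
    (pderiv j)^[n] (fun x => a * f x + b * g x) =
      fun x => a * (pderiv j)^[n] f x + b * (pderiv j)^[n] g x := by
  induction n generalizing f g with
  | zero => rfl
  | succ n ih =>
    have hf' : Differentiable ℝ f := hf.differentiable (by norm_num)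
    have hg' : Differentiable ℝ g := hg.differentiable (by norm_num)
    rw [Function.iterate_succ_apply, pderiv_add (hf'.const_mul a) (hg'.const_mul b),
      pderiv_const_mul hf', pderiv_const_mul hg',
      ih (contDiff_pderiv_top hf j) (contDiff_pderiv_top hg j)]
    rfl

/-- The mixed partial derivative `∂₁ʲ ∂₂ᵏ f`. -/
noncomputable def mixedDeriv (j k : ℕ) (f : Plane → ℂ) : Plane → ℂ :=
  (pderiv 0)^[j] ((pderiv 1)^[k] f)

theorem mixedDeriv_linear {f g : Plane → ℂ} (hf : ContDiff ℝ ∞ f) (hg : ContDiff ℝ ∞ g)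
    (a b : ℂ) (j k : ℕ) :
    mixedDeriv j k (fun x => a * f x + b * g x) =
      fun x => a * mixedDeriv j k f x + b * mixedDeriv j k g x := by
  rw [mixedDeriv, pderiv_iterate_linear hf hg, pderiv_iterate_linear
    (contDiff_pderiv_iterate hf 1 k) (contDiff_pderiv_iterate hg 1 k)]
  rfl

theorem mixedDeriv_congr {f g : Plane → ℂ} {x : Plane} (h : f =ᶠ[𝓝 x] g) (j k : ℕ) :
    mixedDeriv j k f x = mixedDeriv j k g x :=
  (pderiv_iterate_congr (pderiv_iterate_congr h 1 k) 0 j).eq_of_nhds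

theorem mixedDeriv_pderiv_zero {f : Plane → ℂ} (hf : ContDiff ℝ ∞ f) (j k : ℕ) :
    mixedDeriv j k (pderiv 0 f) = mixedDeriv (j + 1) k f := by
  rw [mixedDeriv, pderiv_iterate_comm hf]
  rfl

theorem mixedDeriv_pderiv_one (f : Plane → ℂ) (j k : ℕ) :
    mixedDeriv j k (pderiv 1 f) = mixedDeriv j (k + 1) f := rfl

/-- All partial derivatives of `f` vanish at the origin. -/
def IsFlat (f : Plane → ℂ) : Prop := ∀ j k, mixedDeriv j k f 0 = 0

theorem IsFlat.pderiv {f : Plane → ℂ} (hf : ContDiff ℝ ∞ f) (h : IsFlat f) (i : Fin 2) :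
    IsFlat (pderiv i f) := by
  intro j k
  fin_cases i
  · exact (congrFun (mixedDeriv_pderiv_zero hf j k) 0).trans (h _ _)
  · exact (congrFun (mixedDeriv_pderiv_one f j k) 0).trans (h _ _)

theorem norm_fderiv_le {f : Plane → ℂ} {x : Plane} {K : ℝ} (h : ∀ j, ‖pderiv j f x‖ ≤ K) :
    ‖fderiv ℝ f x‖ ≤ 2 * K := by
  have hK : 0 ≤ K := (norm_nonneg _).trans (h 0)
  refine ContinuousLinearMap.opNorm_le_bound _ (by linarith) fun v => ?_
  rw [fderiv_apply_eq_pderiv]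
  refine (norm_add_le _ _).trans ?_
  rw [norm_mul, norm_mul, Complex.norm_real, Complex.norm_real]
  have h0 := mul_le_mul (PiLp.norm_apply_le v 0) (h 0) (norm_nonneg _) (norm_nonneg v)
  have h1 := mul_le_mul (PiLp.norm_apply_le v 1) (h 1) (norm_nonneg _) (norm_nonneg v)
  linarith

/-- Flatness passes to the partial derivatives, and the mean value inequality from 0 gains one power
of |x| per induction step. -/
theorem IsFlat.isBigO {f : Plane → ℂ} (hf : ContDiff ℝ ∞ f) (h : IsFlat f) (N : ℕ) :
    ∃ K, ∀ᶠ x in 𝓝 (0 : Plane), ‖f x‖ ≤ K * ‖x‖ ^ N := by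
  induction N generalizing f with
  | zero =>
    refine ⟨‖f 0‖ + 1, ?_⟩
    filter_upwards [hf.continuous.norm.continuousAt.eventually
      (gt_mem_nhds (lt_add_one ‖f 0‖))] with x hx
    simpa using hx.le
  | succ N ih =>
    obtain ⟨K₀, h₀⟩ := ih (contDiff_pderiv_top hf 0) (h.pderiv hf 0)
    obtain ⟨K₁, h₁⟩ := ih (contDiff_pderiv_top hf 1) (h.pderiv hf 1)
    obtain ⟨ε, hε, hball⟩ := Metric.eventually_nhds_iff_ball.mp (h₀.and h₁)
    set K := max (max K₀ K₁) 0
    refine ⟨2 * K, ?_⟩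
    filter_upwards [Metric.ball_mem_nhds (0 : Plane) hε] with x hx
    rw [mem_ball_zero_iff] at hx
    have hbound : ∀ y ∈ Metric.closedBall (0 : Plane) ‖x‖, ‖fderiv ℝ f y‖ ≤ 2 * (K * ‖x‖ ^ N) := by
      intro y hy
      rw [mem_closedBall_zero_iff] at hy
      have hb := hball y (by rw [mem_ball_zero_iff]; linarith)
      have hpow : ‖y‖ ^ N ≤ ‖x‖ ^ N := pow_le_pow_left₀ (norm_nonneg _) hy N
      refine norm_fderiv_le fun j => ?_
      fin_cases j
      · exact hb.1.trans (mul_le_mul ((le_max_left _ _).trans (le_max_left _ _)) hpow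
          (by positivity) (le_max_right _ _))
      · exact hb.2.trans (mul_le_mul ((le_max_right _ _).trans (le_max_left _ _)) hpow
          (by positivity) (le_max_right _ _))
    have hmv := (convex_closedBall (0 : Plane) ‖x‖).norm_image_sub_le_of_norm_fderiv_le (𝕜 := ℝ)
      (fun y _ => hf.differentiable (by norm_num) y) hbound
      (Metric.mem_closedBall_self (norm_nonneg x)) (mem_closedBall_zero_iff.mpr le_rfl)
    have hf0 : f 0 = 0 := h 0 0
    rw [hf0, sub_zero, sub_zero] at hmv
    calc ‖f x‖ ≤ 2 * (K * ‖x‖ ^ N) * ‖x‖ := hmv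
      _ = 2 * K * ‖x‖ ^ (N + 1) := by ring

/-! ### Restriction to the sides of the corner -/

theorem eventually_pderiv_eq_zero_of_axis {f : Plane → ℂ} (hf : ContDiff ℝ ∞ f) {j : Fin 2}
    (h : ∀ᶠ t in 𝓝[>] (0 : ℝ), f (t • EuclideanSpace.single j 1) = 0) :
    ∀ᶠ t in 𝓝[>] (0 : ℝ), pderiv j f (t • EuclideanSpace.single j 1) = 0 := by
  obtain ⟨ε, hε, hs⟩ := mem_nhdsGT_iff_exists_Ioo_subset.mp h
  filter_upwards [Ioo_mem_nhdsGT hε] with t ht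
  have h1 : HasDerivAt (fun s : ℝ => f (s • EuclideanSpace.single j (1 : ℝ)))
      (pderiv j f (t • EuclideanSpace.single j 1)) t := by
    have hγ : HasDerivAt (fun s : ℝ => s • (EuclideanSpace.single j (1 : ℝ) : Plane))
        (EuclideanSpace.single j 1) t := by
      simpa using (hasDerivAt_id t).smul_const (EuclideanSpace.single j (1 : ℝ) : Plane)
    exact ((hf.differentiable (by norm_num)) _).hasFDerivAt.comp_hasDerivAt t hγ
  have h2 : (fun s : ℝ => f (s • EuclideanSpace.single j (1 : ℝ))) =ᶠ[𝓝 t] fun _ => 0 := by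
    filter_upwards [isOpen_Ioo.mem_nhds ht] with s hs'
    exact hs hs'
  exact h1.unique ((hasDerivAt_const t (0 : ℂ)).congr_of_eventuallyEq h2)

theorem tendsto_axis (j : Fin 2) :
    Tendsto (fun t : ℝ => t • (EuclideanSpace.single j (1 : ℝ) : Plane)) (𝓝[>] 0) (𝓝 0) := by
  have : Continuous fun t : ℝ => t • (EuclideanSpace.single j (1 : ℝ) : Plane) := by fun_prop
  have h := this.tendsto 0
  rw [zero_smul] at h
  exact h.mono_left nhdsWithin_le_nhds

/-- Tangential derivatives vanish on the open half-axis near the vertex, and reach the vertex by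
continuity. -/
theorem pderiv_iterate_eq_zero_of_axis {f : Plane → ℂ} (hf : ContDiff ℝ ∞ f) {j : Fin 2}
    (h : ∀ᶠ t in 𝓝[>] (0 : ℝ), f (t • EuclideanSpace.single j 1) = 0) (n : ℕ) :
    (pderiv j)^[n] f 0 = 0 := by
  induction n generalizing f with
  | zero =>
    refine tendsto_nhds_unique ((hf.continuous.tendsto 0).comp (tendsto_axis j)) ?_
    exact tendsto_const_nhds.congr' (h.mono fun t ht => ht.symm)
  | succ n ih => exact ih (contDiff_pderiv_top hf j) (eventually_pderiv_eq_zero_of_axis hf h)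

/-! ### From the vector equation to the scalar one -/

theorem isOpen_unitDisc : IsOpen unitDisc := isOpen_lt continuous_norm continuous_const

theorem unitDisc_mem_nhds : unitDisc ∈ 𝓝 (0 : Plane) :=
  isOpen_unitDisc.mem_nhds (by simp [unitDisc])

theorem IsHelmholtzSolution.contDiffOn_apply {q : ℂ} {u : Plane → CVec}
    (hu : IsHelmholtzSolution q u) (i : Fin 2) : ContDiffOn ℝ 2 (fun y => u y i) unitDisc :=
  ((EuclideanSpace.proj (𝕜 := ℂ) i).restrictScalars ℝ).contDiff.comp_contDiffOn hu.1

theorem IsHelmholtzSolution.helmholtzAt {q : ℂ} {u : Plane → CVec}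
    (hu : IsHelmholtzSolution q u) (i : Fin 2) {x : Plane} (hx : x ∈ unitDisc) :
    HelmholtzAt q (fun y => u y i) x := by
  have hc : ContDiffAt ℝ 2 u x := hu.1.contDiffAt (isOpen_unitDisc.mem_nhds hx)
  have hci : ContDiffAt ℝ 2 (fun y => u y i) x :=
    (hu.contDiffOn_apply i).contDiffAt (isOpen_unitDisc.mem_nhds hx)
  have h1 := hc.laplacian_CLM_comp_left (l := (EuclideanSpace.proj (𝕜 := ℂ) i).restrictScalars ℝ)
  have h2 : Laplacian.laplacian (fun y => u y i) x = Laplacian.laplacian u x i := h1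
  have h3 := congrArg (fun z : CVec => z i) (hu.2 x hx)
  simp only [PiLp.add_apply, PiLp.smul_apply, smul_eq_mul, PiLp.zero_apply] at h3
  rw [← h2, InnerProductSpace.laplacian_eq_iteratedFDeriv_orthonormalBasis _
    (EuclideanSpace.basisFun (Fin 2) ℝ)] at h3
  simp only [Fin.sum_univ_two, iteratedFDeriv_two_apply, EuclideanSpace.basisFun_apply,
    Matrix.cons_val_zero, Matrix.cons_val_one] at h3
  rw [HelmholtzAt, pderiv_pderiv_eq hci, pderiv_pderiv_eq hci]
  exact h3

/-- A cutoff makes the field globally C² without changing it on a smaller disc, as the results on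
globally C² functions require. -/
theorem exists_contDiff_eventuallyEq_of_contDiffOn {f : Plane → ℂ} (hf : ContDiffOn ℝ 2 f unitDisc)
    {r : ℝ} (hr : 0 < r) (hr1 : r < 1) :
    ∃ g : Plane → ℂ, ContDiff ℝ 2 g ∧ ∀ x, ‖x‖ < r → f =ᶠ[𝓝 x] g := by
  let χ : ContDiffBump (0 : Plane) := ⟨r, (1 + r) / 2, hr, by linarith⟩
  refine ⟨fun x => χ x • f x, contDiff_iff_contDiffAt.mpr fun x => ?_, fun x hx => ?_⟩
  · rcases lt_or_ge ‖x‖ 1 with h | h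
    · exact χ.contDiff.contDiffAt.smul (hf.contDiffAt (isOpen_unitDisc.mem_nhds h))
    · have hz : (fun x => χ x • f x) =ᶠ[𝓝 x] fun _ => 0 := by
        have ho : IsOpen {y : Plane | (1 + r) / 2 < ‖y‖} := isOpen_lt continuous_const continuous_norm
        filter_upwards [ho.mem_nhds (show (1 + r) / 2 < ‖x‖ by linarith)] with y hy
        have : χ y = 0 := χ.zero_of_le_dist (by rw [dist_zero_right]; exact le_of_lt hy)
        rw [this, zero_smul]
      exact contDiffAt_const.congr_of_eventuallyEq hz
  · have ho : IsOpen {y : Plane | ‖y‖ < r} := isOpen_lt continuous_norm continuous_const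
    filter_upwards [ho.mem_nhds hx] with y hy
    have : χ y = 1 := χ.one_of_mem_closedBall (mem_closedBall_zero_iff.mpr (le_of_lt hy))
    rw [this, one_smul]

theorem eq_zero_of_eventuallyEq_flat {q : ℂ} {u : Plane → CVec} (hu : IsHelmholtzSolution q u)
    (i : Fin 2) {U : Plane → ℂ} (hU : ContDiff ℝ ∞ U) (hflat : IsFlat U)
    (huU : (fun y => u y i) =ᶠ[𝓝 0] U) {x : Plane} (hx : x ∈ unitDisc) : u x i = 0 := by
  have hx' : ‖x‖ < 1 := hx
  obtain ⟨r, hxr, hr1⟩ := exists_between hx'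
  have hr : 0 < r := (norm_nonneg x).trans_lt hxr
  obtain ⟨g, hg, hfg⟩ := exists_contDiff_eventuallyEq_of_contDiffOn (hu.contDiffOn_apply i) hr hr1
  have hgU : g =ᶠ[𝓝 0] U := (hfg 0 (by simpa using hr)).symm.trans huU
  rw [show u x i = g x from (hfg x hxr).eq_of_nhds]
  refine eq_zero_of_flat (q := q) hg (fun y hy => HelmholtzAt.congr (hfg y hy)
    (hu.helmholtzAt i (show ‖y‖ < 1 from hy.trans hr1))) (fun N => ?_) hxr
  obtain ⟨K, hK⟩ := hflat.isBigO hU N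
  obtain ⟨K₀, hK₀⟩ := (hflat.pderiv hU 0).isBigO (contDiff_pderiv_top hU 0) N
  obtain ⟨K₁, hK₁⟩ := (hflat.pderiv hU 1).isBigO (contDiff_pderiv_top hU 1) N
  refine ⟨max K (max K₀ K₁), ?_⟩
  filter_upwards [hK, hK₀, hK₁, hgU, pderiv_congr hgU 0, pderiv_congr hgU 1]
    with y h h0 h1 e e0 e1
  have hp : 0 ≤ ‖y‖ ^ N := by positivity
  refine ⟨?_, fun j => ?_⟩
  · rw [e]
    exact h.trans (mul_le_mul_of_nonneg_right (le_max_left _ _) hp)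
  · fin_cases j
    · simp only [Fin.zero_eta]
      rw [e0]
      exact h0.trans (mul_le_mul_of_nonneg_right ((le_max_left _ _).trans (le_max_right _ _)) hp)
    · simp only [Fin.mk_one]
      rw [e1]
      exact h1.trans (mul_le_mul_of_nonneg_right ((le_max_right _ _).trans (le_max_right _ _)) hp)

theorem exists_contDiff_apply {q : ℂ} {u : Plane → CVec} (hu : IsHelmholtzSolution q u)
    (i : Fin 2) : ∃ U : Plane → ℂ, ContDiff ℝ ∞ U ∧ (fun y => u y i) =ᶠ[𝓝 0] U := by
  obtain ⟨g, hg, hfg⟩ := exists_contDiff_eventuallyEq_of_contDiffOn (hu.contDiffOn_apply i)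
    (r := 1 / 2) (by norm_num) (by norm_num)
  obtain ⟨U, hU, hgU⟩ := exists_contDiff_eventuallyEq (q := q) (R := 1 / 2) (by norm_num) hg
    (fun y hy => HelmholtzAt.congr (hfg y hy)
      (hu.helmholtzAt i (show ‖y‖ < 1 from hy.trans (by norm_num))))
  exact ⟨U, hU, (hfg 0 (by norm_num)).trans hgU⟩

/-- Near the origin, a divergence free solution of the vector Helmholtz equation is determined by
its smooth scalar curl, which solves the scalar Helmholtz equation. -/
theorem exists_curl_potential {q : ℂ} {u : Plane → CVec} (hu : IsHelmholtzSolution q u)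
    (hdiv : ∀ x ∈ unitDisc, divergence u x = 0) :
    ∃ F : Plane → ℂ, ContDiff ℝ ∞ F ∧ curl u =ᶠ[𝓝 0] F ∧
      (∀ᶠ x in 𝓝 0, pderiv 1 F x = q * u x 0) ∧ (∀ᶠ x in 𝓝 0, pderiv 0 F x = -q * u x 1) ∧
      ∀ᶠ x in 𝓝 0, HelmholtzAt q F x := by
  obtain ⟨U, hU, hu0⟩ := exists_contDiff_apply hu 0
  obtain ⟨V, hV, hu1⟩ := exists_contDiff_apply hu 1
  have hdU : ∀ j, ContDiff ℝ ∞ (pderiv j U) := contDiff_pderiv_top hU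
  have hdV : ∀ j, ContDiff ℝ ∞ (pderiv j V) := contDiff_pderiv_top hV
  have hD : ∀ {f : Plane → ℂ}, ContDiff ℝ ∞ f → Differentiable ℝ f :=
    fun hf => hf.differentiable (by norm_num)
  have hF : ContDiff ℝ ∞ fun x => pderiv 0 V x - pderiv 1 U x := (hdV 0).sub (hdU 1)
  have hdivg : (fun x => pderiv 0 U x + pderiv 1 V x) =ᶠ[𝓝 0] fun _ => 0 := by
    filter_upwards [unitDisc_mem_nhds, pderiv_congr hu0 0, pderiv_congr hu1 1] with x hx h0 h1
    rw [← h0, ← h1]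
    exact hdiv x hx
  have hzero : ∀ j, pderiv j (fun _ : Plane => (0 : ℂ)) = fun _ => 0 := fun j => by
    funext x; simp [pderiv]
  have hdiv0 := pderiv_congr hdivg 0
  have hdiv1 := pderiv_congr hdivg 1
  rw [pderiv_add (hD (hdU 0)) (hD (hdV 1)), hzero] at hdiv0 hdiv1
  have hHU : ∀ᶠ x in 𝓝 0, HelmholtzAt q U x := by
    filter_upwards [unitDisc_mem_nhds, hu0.eventuallyEq_nhds] with x hx h
    exact HelmholtzAt.congr h (hu.helmholtzAt 0 hx)
  have hHV : ∀ᶠ x in 𝓝 0, HelmholtzAt q V x := by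
    filter_upwards [unitDisc_mem_nhds, hu1.eventuallyEq_nhds] with x hx h
    exact HelmholtzAt.congr h (hu.helmholtzAt 1 hx)
  have hU2 : ContDiff ℝ 2 U := hU.of_le ENat.LEInfty.out
  have hV2 : ContDiff ℝ 2 V := hV.of_le ENat.LEInfty.out
  -- Differentiating div = 0 turns ∂₂∂₁V into -∂₁²U, so the left side is -ΔU = qU.
  have h1 : pderiv 1 (fun x => pderiv 0 V x - pderiv 1 U x) =ᶠ[𝓝 0] fun x => q * U x := by
    rw [pderiv_sub (hD (hdV 0)) (hD (hdU 1)), pderiv_comm hV2 1 0]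
    filter_upwards [hdiv0, hHU] with x h h'
    unfold HelmholtzAt at h'
    linear_combination h - h'
  have h0 : pderiv 0 (fun x => pderiv 0 V x - pderiv 1 U x) =ᶠ[𝓝 0] fun x => -q * V x := by
    rw [pderiv_sub (hD (hdV 0)) (hD (hdU 1)), pderiv_comm hU2 0 1]
    filter_upwards [hdiv1, hHV] with x h h'
    unfold HelmholtzAt at h'
    linear_combination h' - h
  refine ⟨_, hF, ?_, ?_, ?_, ?_⟩
  · filter_upwards [pderiv_congr hu1 0, pderiv_congr hu0 1] with x h h'
    rw [← h, ← h']
    rfl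
  · filter_upwards [h1, hu0] with x h h'
    rw [h, ← h']
  · filter_upwards [h0, hu1] with x h h'
    rw [h, ← h']
  -- ΔF = ∂₁(-qV) + ∂₂(qU) = -qF, by the definition of F.
  · have h00 := pderiv_congr h0 0
    have h11 := pderiv_congr h1 1
    rw [pderiv_const_mul (hD hV)] at h00
    rw [pderiv_const_mul (hD hU)] at h11
    filter_upwards [h00, h11] with x h h'
    unfold HelmholtzAt
    rw [h, h']
    ring

theorem mixedDeriv_recurrence {q : ℂ} {F : Plane → ℂ} (hF : ContDiff ℝ ∞ F)
    (h : ∀ᶠ x in 𝓝 0, HelmholtzAt q F x) (j k : ℕ) :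
    mixedDeriv (j + 2) k F 0 + mixedDeriv j (k + 2) F 0 = -q * mixedDeriv j k F 0 := by
  have hd : ∀ i, ContDiff ℝ ∞ (pderiv i F) := contDiff_pderiv_top hF
  -- The factors 1 and the term with factor 0 give both sides the shape of `mixedDeriv_linear`.
  have hc : (fun x => 1 * pderiv 0 (pderiv 0 F) x + 1 * pderiv 1 (pderiv 1 F) x) =ᶠ[𝓝 0]
      fun x => -q * F x + 0 * F x := by
    filter_upwards [h] with x hx
    unfold HelmholtzAt at hx
    linear_combination hx
  have := mixedDeriv_congr hc j k
  rw [mixedDeriv_linear (contDiff_pderiv_top (hd 0) 0) (contDiff_pderiv_top (hd 1) 1),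
    mixedDeriv_linear hF hF, mixedDeriv_pderiv_zero (hd 0), mixedDeriv_pderiv_zero hF,
    mixedDeriv_pderiv_one, mixedDeriv_pderiv_one] at this
  linear_combination this

/-- Near 0 the field is q⁻¹(∂₂F, -∂₁F), so its components are flat with F and strong unique
continuation applies. -/
theorem eq_zero_of_isFlat_curl {q : ℂ} (hq : q ≠ 0) {u : Plane → CVec}
    (hu : IsHelmholtzSolution q u) {F : Plane → ℂ} (hF : ContDiff ℝ ∞ F)
    (h1 : ∀ᶠ x in 𝓝 0, pderiv 1 F x = q * u x 0) (h0 : ∀ᶠ x in 𝓝 0, pderiv 0 F x = -q * u x 1)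
    (hflat : IsFlat F) {x : Plane} (hx : x ∈ unitDisc) : u x = 0 := by
  have hflat' : ∀ (c : ℂ) (i : Fin 2), IsFlat fun y => c * pderiv i F y + 0 * pderiv i F y := by
    intro c i j k
    have hd := contDiff_pderiv_top hF i
    rw [mixedDeriv_linear hd hd]
    simp only [(hflat.pderiv hF i) j k, mul_zero, add_zero]
  have hsm : ∀ (c : ℂ) (i : Fin 2),
      ContDiff ℝ ∞ fun y => c * pderiv i F y + 0 * pderiv i F y := fun c i =>
    (contDiff_const.mul (contDiff_pderiv_top hF i)).add
      (contDiff_const.mul (contDiff_pderiv_top hF i))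
  ext i
  fin_cases i
  · refine eq_zero_of_eventuallyEq_flat hu 0 (hsm q⁻¹ 1) (hflat' q⁻¹ 1) ?_ hx
    filter_upwards [h1] with y hy
    rw [hy]; field_simp; ring
  · refine eq_zero_of_eventuallyEq_flat hu 1 (hsm (-q⁻¹) 0) (hflat' (-q⁻¹) 0) ?_ hx
    filter_upwards [h0] with y hy
    rw [hy]; field_simp; ring

theorem axis_mem_corner (j : Fin 2) {t : ℝ} (ht : 0 ≤ t) :
    t • (EuclideanSpace.single j (1 : ℝ) : Plane) ∈ corner := by
  fin_cases j
  · exact Or.inl (by simp [ht])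
  · exact Or.inr (by simp [ht])

theorem dot_tangent_axis (j : Fin 2) {t : ℝ} (ht : 0 < t) (z : CVec) :
    dot (tangent (t • EuclideanSpace.single j 1)) z = z j := by
  fin_cases j <;> simp [dot, tangent, ht.ne']

end CornerMaxwell

/-! ### Matching the Taylor coefficients of the two curls at the vertex -/

open CornerMaxwell
theorem lemma2p1 (q₁ q₂ : ℂ) (hq₁ : q₁ ≠ 0) (hq₂ : q₂ ≠ 0) (hq : q₁ ≠ q₂)
    (u v : CornerMaxwell.Plane → CornerMaxwell.CVec)
    (hu : CornerMaxwell.IsHelmholtzSolution q₁ u)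
    (hv : CornerMaxwell.IsHelmholtzSolution q₂ v)
    (hdivu : ∀ x ∈ CornerMaxwell.unitDisc, CornerMaxwell.divergence u x = 0)
    (hdivv : ∀ x ∈ CornerMaxwell.unitDisc, CornerMaxwell.divergence v x = 0)
    (htan : ∀ x ∈ CornerMaxwell.unitDisc ∩ CornerMaxwell.corner, x ≠ 0 →
      CornerMaxwell.dot (CornerMaxwell.tangent x) (u x) =
        CornerMaxwell.dot (CornerMaxwell.tangent x) (v x))
    (hcurl : ∀ x ∈ CornerMaxwell.unitDisc ∩ CornerMaxwell.corner,
      CornerMaxwell.curl u x = CornerMaxwell.curl v x) :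
    (∀ x ∈ CornerMaxwell.unitDisc, u x = 0) ∧ (∀ x ∈ CornerMaxwell.unitDisc, v x = 0) := by
  obtain ⟨F, hF, hFc, hF1, hF0, hFH⟩ := exists_curl_potential hu hdivu
  obtain ⟨G, hG, hGc, hG1, hG0, hGH⟩ := exists_curl_potential hv hdivv
  have hdF := contDiff_pderiv_top hF
  have hdG := contDiff_pderiv_top hG
  have hcurlAxis : ∀ j n, (pderiv j)^[n] F 0 = (pderiv j)^[n] G 0 := by
    intro j n
    have h := pderiv_iterate_eq_zero_of_axis (f := fun x => 1 * F x + -1 * G x) (j := j)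
      ((contDiff_const.mul hF).add (contDiff_const.mul hG)) (by
        filter_upwards [self_mem_nhdsWithin, (tendsto_axis j).eventually unitDisc_mem_nhds,
          (tendsto_axis j).eventually hFc, (tendsto_axis j).eventually hGc] with t ht hd h1 h2
        have := hcurl _ ⟨hd, axis_mem_corner j (le_of_lt ht)⟩
        rw [← h1, ← h2, this]
        ring) n
    rw [pderiv_iterate_linear hF hG] at h
    linear_combination h
  have htanAxis : ∀ j, ∀ᶠ t in 𝓝[>] (0 : ℝ), u (t • EuclideanSpace.single j 1) j =
      v (t • EuclideanSpace.single j 1) j := by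
    intro j
    filter_upwards [self_mem_nhdsWithin, (tendsto_axis j).eventually unitDisc_mem_nhds] with t ht hd
    have := htan _ ⟨hd, axis_mem_corner j (le_of_lt ht)⟩
      (smul_ne_zero (ne_of_gt ht) (by simp))
    rwa [dot_tangent_axis j ht, dot_tangent_axis j ht] at this
  -- For i ≠ j, ∂ᵢF and ∂ᵢG are, up to a common sign, q₁uⱼ and q₂vⱼ, so equality of tangential
  -- components on side j is this cross-multiplied identity.
  have hnormal : ∀ j i, (∀ᶠ t in 𝓝[>] (0 : ℝ),
      q₂ * pderiv i F (t • EuclideanSpace.single j 1) =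
        q₁ * pderiv i G (t • EuclideanSpace.single j 1)) → ∀ n,
      (pderiv j)^[n] (pderiv i F) 0 = q₁ / q₂ * (pderiv j)^[n] (pderiv i G) 0 := by
    intro j i hji n
    have h := pderiv_iterate_eq_zero_of_axis
      (f := fun x => q₂ * pderiv i F x + -q₁ * pderiv i G x) (j := j)
      ((contDiff_const.mul (hdF i)).add (contDiff_const.mul (hdG i))) (by
        filter_upwards [hji] with t ht
        rw [ht]
        ring) n
    rw [pderiv_iterate_linear (hdF i) (hdG i)] at h
    field_simp
    linear_combination h
  have key := taylorCoeff_eq_zero hq₁ hq₂ hq (a := fun j k => mixedDeriv j k F 0)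
    (b := fun j k => mixedDeriv j k G 0) (mixedDeriv_recurrence hF hFH)
    (mixedDeriv_recurrence hG hGH) (hcurlAxis 0) (hcurlAxis 1)
    (hnormal 0 1 (by
      filter_upwards [htanAxis 0, (tendsto_axis 0).eventually hF1,
        (tendsto_axis 0).eventually hG1] with t ht h1 h2
      rw [h1, h2, ht]
      ring))
    (fun k => by
      have h := hnormal 1 0 (by
        filter_upwards [htanAxis 1, (tendsto_axis 1).eventually hF0,
          (tendsto_axis 1).eventually hG0] with t ht h1 h2
        rw [h1, h2, ht]
        ring) k
      rwa [pderiv_iterate_comm hF, pderiv_iterate_comm hG] at h)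
  exact ⟨fun x hx => eq_zero_of_isFlat_curl hq₁ hu hF hF1 hF0 (fun j k => (key j k).1) hx,
    fun x hx => eq_zero_of_isFlat_curl hq₂ hv hG hG1 hG0 (fun j k => (key j k).2) hx⟩
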